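/- Let $f$ be a real quadratic form on $\mathbb R^{3\times 3}$. Call $f$ quasiconvex if it is rank-one convex (for quadratic forms the two notions coincide), that is, $f(\theta A+(1-\theta)B)\le \theta f(A)+(1-\theta)f(B)$ for all $\theta\in(0,1)$ and all $A,B\in\mathbb R^{3\times3}$ such that $A-B=x\otimes y$ for some $x,y\in\mathbb R^3$. A rank-one form is the square $\xi\mapsto \ell(\xi)^2$ of a nonzero linear form $\ell$ on $\mathbb R^{3\times 3}$. The form $f$ is extremal if it is quasiconvex and $f-\ell^2$ is not quasiconvex for any nonzero linear form $\ell$. It is polyconvex if $f(\xi)=F(\xi,\operatorname{adj}\xi,\det\xi)$ for all $\xi\in\mathbb R^{3\times3}$, for some convex function $F:\mathbb R^{3\times3}\times\mathbb R^{3\times3}\times\mathbb R\to\mathbb R$. The acoustic tensor of $f$ is the symmetric $3\times3$ matrix $T_f(y)$, whose entries are quadratic forms in $y\in\mathbb R^3$, such that $f(x\otimes y)=x\,T_f(y)\,x^T$ for all $x,y\in\mathbb R^3$. **Theorem 3.7.** Let $f$ be a quasiconvex quadratic form on $\mathbb R^{3\times3}$, and suppose that $\det T_f(y)$ is a perfect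 square, i.e. $\det T_f(y)=p(y)^2$ for some polynomial $p\in\mathbb R[y_1,y_2,y_3]$. Then at least one of the following holds: (i) $f$ is extremal; (ii) $f$ is polyconvex; (iii) $f=\ell^2+g$, where $\ell$ is a nonzero linear form on $\mathbb R^{3\times 3}$ and $g$ is an extremal quadratic form with $\det T_g(y)=0$ for all $y\in\mathbb R^3$. -/

import Mathlib

/-- Real `3 × 3` matrices. -/
abbrev Mat3 : Type := Matrix (Fin 3) (Fin 3) ℝ

/-- Quasiconvexity, which for quadratic functions is the same as rank-one convexity: `f` is convex
along every segment whose end points differ by a rank-one matrix `x ⊗ y`. -/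
def IsQuasiconvexForm (f : QuadraticForm ℝ Mat3) : Prop :=
  ∀ (A B : Mat3) (x y : Fin 3 → ℝ), A - B = Matrix.vecMulVec x y →
    ∀ θ : ℝ, 0 < θ → θ < 1 → f (θ • A + (1 - θ) • B) ≤ θ * f A + (1 - θ) * f B

/-- The rank-one form `ξ ↦ ℓ(ξ)²`, the square of a linear form `ℓ`. -/
noncomputable def squareForm (ℓ : Mat3 →ₗ[ℝ] ℝ) : QuadraticForm ℝ Mat3 :=
  QuadraticMap.linMulLin ℓ ℓ

/-- Extremality in the sense of Milton: the form is quasiconvex, and subtracting the square of any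
nonzero linear form destroys quasiconvexity. -/
def IsExtremalForm (f : QuadraticForm ℝ Mat3) : Prop :=
  IsQuasiconvexForm f ∧
    ∀ ℓ : Mat3 →ₗ[ℝ] ℝ, ℓ ≠ 0 → ¬ IsQuasiconvexForm (f - squareForm ℓ)

/-- Polyconvexity: `f ξ` is a convex function of `ξ`, of its `2 × 2` minors (the entries of the
adjugate, up to sign and order) and of its determinant. -/
def IsPolyconvexForm (f : QuadraticForm ℝ Mat3) : Prop :=
  ∃ F : Mat3 × Mat3 × ℝ → ℝ, ConvexOn ℝ Set.univ F ∧
    ∀ ξ : Mat3, f ξ = F (ξ, ξ.adjugate, ξ.det)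

/-- The acoustic tensor (`y`-matrix) of `f`: the symmetric matrix `T(y)`, with entries quadratic
in `y`, such that `f (x ⊗ y) = x T(y) xᵀ`. Its `(i, k)` entry is the value of the symmetric bilinear
form of `f` at `(eᵢ ⊗ y, eₖ ⊗ y)`. -/
noncomputable def acousticTensor (f : QuadraticForm ℝ Mat3) (y : Fin 3 → ℝ) : Mat3 :=
  Matrix.of fun i k =>
    QuadraticMap.associated (R := ℝ) f
      (Matrix.vecMulVec (Pi.single i 1) y) (Matrix.vecMulVec (Pi.single k 1) y)

/-!
The form `f` is recorded by the biquadratic form `f (x ⊗ y)`, which is nonnegative because `f` is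
quasiconvex. If a positive semidefinite quadratic form takes the same values as `f` at all
rank-one matrices (`HasPosSemidefRep f`), then `f` is that form plus a linear function of the
adjugate, hence polyconvex. It turns out that `f` is always extremal or polyconvex, so the third
alternative of the theorem is never needed.

The central fact is that `HasPosSemidefRep f` holds as soon as the acoustic tensor is singular on
a plane (`hasPosSemidefRep_of_det_eq_zero_on_plane`). On the plane `y₂ = 0`, the form `f (x ⊗ y)`
is biquadratic in `3` and `2` variables, hence by Calderón's theorem (`exists_posSemidef_rep_two`)
the restriction of a positive semidefinite form, whose kernel is a subspace of `ℝ² ⊗ ℝ³`. A kernel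
vector `x` of the acoustic tensor at `y = (s, t, 0)` can therefore be chosen to be a polynomial in
`(s, t)` of degree `0`, `1` or `2` with linearly independent coefficients (`exists_kernel_curve`).
Being nonnegative, `f (x ⊗ y)` is critical along this curve of zeros, which leaves few
coefficients. In degree `0` one completes a square and uses Calderón's theorem once more. In
degree `1` the form is a quadratic form in six bilinear quantities with values dense in a quadric, and
the S-lemma applies. In degree `2` it is a quadratic form in five bilinear quantities with dense
values.

Let `det T = p ^ 2`, and suppose that `f` is not extremal, so that `f - ℓ ^ 2` is quasiconvex for
some `ℓ ≠ 0`. Writing `ℓ (x ⊗ y) = x ⬝ b y`, the sextic form `q = b ⬝ adj T b` satisfies `0 ≤ q ≤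
p ^ 2`. Either the cubic form `p` vanishes on a plane, which is the case above, or `q = k p ^ 2`
for a constant `k` (`exists_plane_or_proportional`): in an affine chart `p` is a monic cubic in
`z` over `ℝ[u]`, without a root in `ℝ[u]` and therefore irreducible over `ℝ(u)`, and it has a real
zero over each real `u`, so it divides every polynomial that vanishes on its real zero set. In the
second case `f - k⁻¹ ℓ ^ 2` is still nonnegative by Cauchy–Schwarz and its acoustic tensor is
singular everywhere, so the central fact applies to it.
-/

namespace QuasiconvexForm

open Matrix

/-! ### Real quadratic forms -/

section QuadraticForms

variable {M : Type*} [AddCommGroup M] [Module ℝ M]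

local notation "𝐁" => QuadraticMap.associated (R := ℝ)

theorem map_add_eq_associated (Q : QuadraticForm ℝ M) (a b : M) :
    Q (a + b) = Q a + 2 * 𝐁 Q a b + Q b := by
  have h := LinearMap.congr_fun₂ (QuadraticMap.two_nsmul_associated ℝ Q) a b
  simp only [LinearMap.smul_apply, nsmul_eq_mul, Nat.cast_ofNat,
    QuadraticMap.polarBilin_apply_apply, QuadraticMap.polar] at h
  linarith

theorem map_add_smul_eq_associated (Q : QuadraticForm ℝ M) (a b : M) (t : ℝ) :
    Q (a + t • b) = Q a + 2 * t * 𝐁 Q a b + t ^ 2 * Q b := by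
  rw [map_add_eq_associated, QuadraticMap.map_smul, map_smul]
  simp only [smul_eq_mul]
  ring

theorem associated_comm (Q : QuadraticForm ℝ M) (a b : M) : 𝐁 Q a b = 𝐁 Q b a :=
  QuadraticMap.associated_isSymm ℝ Q a b

theorem associated_self (Q : QuadraticForm ℝ M) (a : M) : 𝐁 Q a a = Q a :=
  QuadraticMap.associated_eq_self_apply ℝ Q a

/-- A zero of a quadratic form that is nonnegative along a line through that zero is a critical
point along the line. -/
theorem associated_eq_zero_of_nonneg_line {Q : QuadraticForm ℝ M} {a b : M} (ha : Q a = 0)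
    (h : ∀ t : ℝ, 0 ≤ Q (a + t • b)) : 𝐁 Q a b = 0 := by
  have hd := discrim_le_zero (a := Q b) (b := 2 * 𝐁 Q a b) (c := 0) (fun t => by
    have := h t
    rw [map_add_smul_eq_associated, ha] at this
    linarith)
  unfold discrim at hd
  have : (𝐁 Q a b) ^ 2 ≤ 0 := by linarith
  exact pow_eq_zero_iff (two_ne_zero) |>.1 (le_antisymm this (sq_nonneg _))

theorem associated_eq_zero_of_nonneg {Q : QuadraticForm ℝ M} (h : ∀ v, 0 ≤ Q v) {a : M}
    (ha : Q a = 0) (b : M) : 𝐁 Q a b = 0 :=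
  associated_eq_zero_of_nonneg_line ha fun _ => h _

theorem map_add_of_nonneg_of_map_eq_zero {Q : QuadraticForm ℝ M} (h : ∀ v, 0 ≤ Q v) {a : M}
    (ha : Q a = 0) (b : M) : Q (a + b) = Q b := by
  rw [map_add_eq_associated, associated_eq_zero_of_nonneg h ha, ha]
  ring

/-- The null vectors of a nonnegative quadratic form, which form a subspace. -/
def nullSubmodule (Q : QuadraticForm ℝ M) (h : ∀ v, 0 ≤ Q v) : Submodule ℝ M where
  carrier := {v | Q v = 0}
  add_mem' {a b} ha hb := by
    simp only [Set.mem_ofPred_eq] at *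
    rw [map_add_of_nonneg_of_map_eq_zero h ha, hb]
  zero_mem' := QuadraticMap.map_zero Q
  smul_mem' c v hv := by
    simp only [Set.mem_ofPred_eq] at *
    rw [QuadraticMap.map_smul, hv, smul_zero]

theorem mem_nullSubmodule {Q : QuadraticForm ℝ M} {h : ∀ v, 0 ≤ Q v} {v : M} :
    v ∈ nullSubmodule Q h ↔ Q v = 0 := Iff.rfl

/-- Cauchy–Schwarz for a nonnegative quadratic form. -/
theorem sq_associated_le {Q : QuadraticForm ℝ M} (h : ∀ v, 0 ≤ Q v) (a b : M) :
    (𝐁 Q a b) ^ 2 ≤ Q a * Q b := by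
  have hd := discrim_le_zero (a := Q b) (b := 2 * 𝐁 Q a b) (c := Q a) (fun t => by
    have := h (a + t • b)
    rw [map_add_smul_eq_associated] at this
    linarith)
  unfold discrim at hd
  linarith

theorem convexOn_of_nonneg {Q : QuadraticForm ℝ M} (h : ∀ v, 0 ≤ Q v) :
    ConvexOn ℝ Set.univ Q := by
  refine ⟨convex_univ, fun x _ y _ a b ha hb hab => ?_⟩
  have h1 := h (x - y)
  have e : x - y = x + (-1 : ℝ) • y := by simp [sub_eq_add_neg]
  rw [e, map_add_smul_eq_associated] at h1
  rw [map_add_smul_eq_associated, QuadraticMap.map_smul, map_smul]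
  simp only [smul_eq_mul, LinearMap.smul_apply]
  obtain rfl : b = 1 - a := by linarith
  nlinarith [mul_nonneg (mul_nonneg ha hb) h1]

end QuadraticForms

/-! ### Quadratic forms on rank-one matrices -/

/-- `f` takes nonnegative values at rank-one matrices. -/
def IsNonnegOnRankOne (f : QuadraticForm ℝ Mat3) : Prop :=
  ∀ x y : Fin 3 → ℝ, 0 ≤ f (vecMulVec x y)

/-- Some positive semidefinite quadratic form takes the same values as `f` at all rank-one
matrices. Equivalently, the biquadratic form `f (x ⊗ y)` is a sum of squares of bilinear forms. -/
def HasPosSemidefRep (f : QuadraticForm ℝ Mat3) : Prop :=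
  ∃ g : QuadraticForm ℝ Mat3, (∀ ξ, 0 ≤ g ξ) ∧ ∀ x y, g (vecMulVec x y) = f (vecMulVec x y)

theorem isNonnegOnRankOne_of_isQuasiconvexForm {f : QuadraticForm ℝ Mat3}
    (hf : IsQuasiconvexForm f) : IsNonnegOnRankOne f := by
  intro x y
  have h := hf (vecMulVec x y) 0 x y (sub_zero _) (1 / 2) (by norm_num) (by norm_num)
  simp only [smul_zero, add_zero, QuadraticMap.map_smul, QuadraticMap.map_zero, smul_eq_mul] at h
  linarith

theorem associated_left_eq_zero {f : QuadraticForm ℝ Mat3} (hf : IsNonnegOnRankOne f)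
    {x y : Fin 3 → ℝ} (h : f (vecMulVec x y) = 0) (x' : Fin 3 → ℝ) :
    QuadraticMap.associated (R := ℝ) f (vecMulVec x y) (vecMulVec x' y) = 0 := by
  refine associated_eq_zero_of_nonneg_line h fun t => ?_
  rw [← smul_vecMulVec, ← add_vecMulVec]
  exact hf _ _

theorem associated_right_eq_zero {f : QuadraticForm ℝ Mat3} (hf : IsNonnegOnRankOne f)
    {x y : Fin 3 → ℝ} (h : f (vecMulVec x y) = 0) (y' : Fin 3 → ℝ) :
    QuadraticMap.associated (R := ℝ) f (vecMulVec x y) (vecMulVec x y') = 0 := by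
  refine associated_eq_zero_of_nonneg_line h fun t => ?_
  rw [← vecMulVec_smul, ← vecMulVec_add]
  exact hf _ _

theorem matrix_eq_sum_single (ξ : Mat3) :
    ξ = ∑ i, ∑ j, ξ i j • vecMulVec (Pi.single i (1 : ℝ)) (Pi.single j (1 : ℝ)) := by
  ext a b
  fin_cases a <;> fin_cases b <;> simp [Fin.sum_univ_three, vecMulVec_apply]

/-- The Gram matrix of `f` in the basis of elementary matrices. -/
noncomputable def gram (f : QuadraticForm ℝ Mat3) (i j k l : Fin 3) : ℝ :=
  QuadraticMap.associated (R := ℝ) f (vecMulVec (Pi.single i 1) (Pi.single j 1))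
    (vecMulVec (Pi.single k 1) (Pi.single l 1))

theorem gram_comm (f : QuadraticForm ℝ Mat3) (i j k l : Fin 3) :
    gram f i j k l = gram f k l i j := associated_comm _ _ _

theorem associated_eq_sum_gram (f : QuadraticForm ℝ Mat3) (ξ η : Mat3) :
    QuadraticMap.associated (R := ℝ) f ξ η =
      ∑ i, ∑ j, ∑ k, ∑ l, ξ i j * η k l * gram f i j k l := by
  rw [associated_comm]
  conv_lhs => rw [matrix_eq_sum_single ξ, matrix_eq_sum_single η]
  simp only [map_sum, LinearMap.sum_apply, map_smul, LinearMap.smul_apply, smul_eq_mul,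
    Finset.mul_sum, gram]
  refine Finset.sum_congr rfl fun i _ => Finset.sum_congr rfl fun j _ => ?_
  refine Finset.sum_congr rfl fun k _ => Finset.sum_congr rfl fun l _ => ?_
  rw [associated_comm]
  ring

theorem apply_eq_sum_gram (f : QuadraticForm ℝ Mat3) (ξ : Mat3) :
    f ξ = ∑ i, ∑ j, ∑ k, ∑ l, ξ i j * ξ k l * gram f i j k l := by
  rw [← associated_self, associated_eq_sum_gram]

theorem gram_symm_of_eq_zero {f : QuadraticForm ℝ Mat3} (hf : ∀ x y, f (vecMulVec x y) = 0)
    (i j k l : Fin 3) : gram f i j k l + gram f i l k j = 0 := by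
  have B : ∀ a b : Mat3, f (a + b) = f a + 2 * QuadraticMap.associated (R := ℝ) f a b + f b :=
    map_add_eq_associated f
  set e : Fin 3 → Fin 3 → ℝ := fun i => Pi.single i 1
  have h := hf (e i + e k) (e j + e l)
  rw [add_vecMulVec, vecMulVec_add, vecMulVec_add] at h
  have h1 : ∀ a j l, QuadraticMap.associated (R := ℝ) f (vecMulVec (e a) (e j))
      (vecMulVec (e a) (e l)) = 0 := fun a j l =>
    associated_right_eq_zero (fun x y => (hf x y).ge) (hf _ _) _
  have h2 : ∀ a j l, QuadraticMap.associated (R := ℝ) f (vecMulVec (e j) (e a))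
      (vecMulVec (e l) (e a)) = 0 := fun a j l =>
    associated_left_eq_zero (fun x y => (hf x y).ge) (hf _ _) _
  rw [B, B, B] at h
  simp only [map_add, LinearMap.add_apply, h1, h2, hf] at h
  have e1 : gram f i j k l = QuadraticMap.associated (R := ℝ) f (vecMulVec (e i) (e j))
      (vecMulVec (e k) (e l)) := rfl
  have e2 : gram f i l k j = QuadraticMap.associated (R := ℝ) f (vecMulVec (e i) (e l))
      (vecMulVec (e k) (e j)) := rfl
  rw [e1, e2]
  linarith

/-- A quadratic form that vanishes at all rank-one matrices is a linear function of the
adjugate, that is, of the `2 × 2` minors. -/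
theorem exists_linear_adjugate {f : QuadraticForm ℝ Mat3} (hf : ∀ x y, f (vecMulVec x y) = 0) :
    ∃ L : Mat3 →ₗ[ℝ] ℝ, ∀ ξ, f ξ = L ξ.adjugate := by
  have s := gram_symm_of_eq_zero hf
  have z1 : ∀ i j l, gram f i j i l = 0 := fun i j l => by
    have h1 := s i j i l
    have h2 := gram_comm f i l i j
    linarith
  have z2 : ∀ i j k, gram f i j k j = 0 := fun i j k => by
    have h1 := s i j k j
    linarith
  let en : Fin 3 → Fin 3 → Mat3 →ₗ[ℝ] ℝ := fun i j => Matrix.entryLinearMap ℝ ℝ i j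
  refine ⟨(2 * gram f 1 1 2 2) • en 0 0 - (2 * gram f 0 1 2 2) • en 0 1
      + (2 * gram f 0 1 1 2) • en 0 2
      - (2 * gram f 1 0 2 2) • en 1 0 + (2 * gram f 0 0 2 2) • en 1 1
      - (2 * gram f 0 0 1 2) • en 1 2
      + (2 * gram f 1 0 2 1) • en 2 0 - (2 * gram f 0 0 2 1) • en 2 1
      + (2 * gram f 0 0 1 1) • en 2 2, fun ξ => ?_⟩
  have c := gram_comm f
  rw [apply_eq_sum_gram]
  simp only [Fin.sum_univ_three, z1, z2, LinearMap.add_apply, LinearMap.sub_apply,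
    LinearMap.smul_apply, smul_eq_mul, en, Matrix.entryLinearMap_apply, adjugate_fin_three,
    of_apply, cons_val', cons_val_zero, cons_val_one, cons_val, mul_zero, add_zero, zero_add]
  rw [c 1 0 0 1, c 1 0 0 2, c 1 1 0 0, c 1 1 0 2, c 1 2 0 0, c 1 2 0 1, c 2 0 0 1, c 2 0 0 2,
    c 2 1 0 0, c 2 1 0 2, c 2 2 0 0, c 2 2 0 1, c 2 0 1 1, c 2 0 1 2, c 2 1 1 0, c 2 1 1 2,
    c 2 2 1 0, c 2 2 1 1]
  -- each `gram f i l k j` is minus `gram f i j k l`, which pairs the remaining terms into minors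
  linear_combination (2 * ξ 0 1 * ξ 1 0) * s 0 0 1 1 + (2 * ξ 0 2 * ξ 1 0) * s 0 0 1 2
    + (2 * ξ 0 2 * ξ 1 1) * s 0 1 1 2 + (2 * ξ 0 1 * ξ 2 0) * s 0 0 2 1
    + (2 * ξ 0 2 * ξ 2 0) * s 0 0 2 2 + (2 * ξ 0 2 * ξ 2 1) * s 0 1 2 2
    + (2 * ξ 1 1 * ξ 2 0) * s 1 0 2 1 + (2 * ξ 1 2 * ξ 2 0) * s 1 0 2 2
    + (2 * ξ 1 2 * ξ 2 1) * s 1 1 2 2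

theorem HasPosSemidefRep.isPolyconvexForm {f : QuadraticForm ℝ Mat3} (hf : HasPosSemidefRep f) :
    IsPolyconvexForm f := by
  obtain ⟨g, hg, hfg⟩ := hf
  obtain ⟨L, hL⟩ := exists_linear_adjugate (f := f - g) (fun x y => by
    simp [hfg])
  refine ⟨fun p => g p.1 + L p.2.1, ?_, fun ξ => ?_⟩
  · exact ((convexOn_of_nonneg hg).comp_linearMap (LinearMap.fst ℝ Mat3 (Mat3 × ℝ))).add
      ((L ∘ₗ LinearMap.fst ℝ Mat3 ℝ ∘ₗ LinearMap.snd ℝ Mat3 (Mat3 × ℝ)).convexOn convex_univ)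
  · simp [← hL]

theorem HasPosSemidefRep.add_squareForm {f : QuadraticForm ℝ Mat3} {c : ℝ} (hc : 0 ≤ c)
    {ℓ : Mat3 →ₗ[ℝ] ℝ} (hf : HasPosSemidefRep (f - c • squareForm ℓ)) : HasPosSemidefRep f := by
  obtain ⟨g, hg, hfg⟩ := hf
  refine ⟨g + c • squareForm ℓ, fun ξ => ?_, fun x y => ?_⟩
  · have := mul_nonneg hc (mul_self_nonneg (ℓ ξ))
    simpa [squareForm] using add_nonneg (hg ξ) this
  · simp [hfg]

/-- The change of variables `x ⊗ y ↦ P x ⊗ Q y`, as a linear map on matrices. -/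
noncomputable def coordChange (P Q : (Fin 3 → ℝ) →ₗ[ℝ] (Fin 3 → ℝ)) : Mat3 →ₗ[ℝ] Mat3 where
  toFun ξ := LinearMap.toMatrix' P * ξ * (LinearMap.toMatrix' Q)ᵀ
  map_add' a b := by rw [mul_add, add_mul]
  map_smul' c a := by simp

theorem coordChange_vecMulVec (P Q : (Fin 3 → ℝ) →ₗ[ℝ] (Fin 3 → ℝ)) (x y : Fin 3 → ℝ) :
    coordChange P Q (vecMulVec x y) = vecMulVec (P x) (Q y) := by
  simp only [coordChange, LinearMap.coe_mk, AddHom.coe_mk, mul_vecMulVec, vecMulVec_mul,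
    vecMul_transpose, LinearMap.toMatrix'_mulVec]

theorem IsNonnegOnRankOne.comp_coordChange {f : QuadraticForm ℝ Mat3} (hf : IsNonnegOnRankOne f)
    (P Q : (Fin 3 → ℝ) →ₗ[ℝ] (Fin 3 → ℝ)) : IsNonnegOnRankOne (f.comp (coordChange P Q)) := by
  intro x y
  rw [QuadraticMap.comp_apply, coordChange_vecMulVec]
  exact hf _ _

theorem HasPosSemidefRep.of_comp_coordChange {f : QuadraticForm ℝ Mat3}
    (P Q : (Fin 3 → ℝ) ≃ₗ[ℝ] (Fin 3 → ℝ))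
    (h : HasPosSemidefRep (f.comp (coordChange P.toLinearMap Q.toLinearMap))) :
    HasPosSemidefRep f := by
  obtain ⟨g, hg, hfg⟩ := h
  refine ⟨g.comp (coordChange P.symm.toLinearMap Q.symm.toLinearMap), fun ξ => hg _,
    fun x y => ?_⟩
  rw [QuadraticMap.comp_apply, coordChange_vecMulVec, hfg, QuadraticMap.comp_apply,
    coordChange_vecMulVec]
  simp

/-! ### Calderón's theorem on biquadratic forms in two and `n` variables -/

universe u

section TwoByN

theorem nonneg_of_quadratic_nonneg_of_ne_zero {a b c : ℝ}
    (h : ∀ t : ℝ, t ≠ 0 → 0 ≤ a + b * t + c * t ^ 2) : 0 ≤ a := by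
  have hc : Filter.Tendsto (fun t : ℝ => a + b * t + c * t ^ 2) (nhdsWithin 0 {0}ᶜ) (nhds a) := by
    have : Continuous fun t : ℝ => a + b * t + c * t ^ 2 := by fun_prop
    simpa using (this.tendsto 0).mono_left nhdsWithin_le_nhds
  exact ge_of_tendsto hc (Filter.eventually_of_mem self_mem_nhdsWithin fun t ht => h t ht)

variable {V : Type*} [AddCommGroup V] [Module ℝ V]

/-- Completing the square at a zero `(1, 0) ⊗ v₀`: a vector `v` is split as `φ v • v₀ + w` with
`w ∈ ker φ`. -/
theorem exists_posSemidef_rep_of_zero [FiniteDimensional ℝ V]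
    (ih : ∀ W : Submodule ℝ V, Module.finrank ℝ W < Module.finrank ℝ V →
      ∀ Q : QuadraticForm ℝ (W × W), (∀ (s t : ℝ) (w : W), 0 ≤ Q (s • w, t • w)) →
        ∃ g : QuadraticForm ℝ (W × W), (∀ z, 0 ≤ g z) ∧
          ∀ (s t : ℝ) (w : W), g (s • w, t • w) = Q (s • w, t • w))
    (Q : QuadraticForm ℝ (V × V)) (hQ : ∀ (s t : ℝ) (v : V), 0 ≤ Q (s • v, t • v))
    {v₀ : V} (hv₀ : v₀ ≠ 0) (hz : Q (v₀, 0) = 0) :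
    ∃ g : QuadraticForm ℝ (V × V), (∀ z, 0 ≤ g z) ∧
      ∀ (s t : ℝ) (v : V), g (s • v, t • v) = Q (s • v, t • v) := by
  obtain ⟨φ, hφ⟩ : ∃ φ : V →ₗ[ℝ] ℝ, φ v₀ = 1 := by
    obtain ⟨ψ, hψ⟩ : ∃ ψ : V →ₗ[ℝ] ℝ, ψ v₀ ≠ 0 := by
      by_contra! h
      exact hv₀ ((Module.forall_dual_apply_eq_zero_iff ℝ v₀).1 h)
    exact ⟨(ψ v₀)⁻¹ • ψ, by simp [hψ]⟩
  set W : Submodule ℝ V := LinearMap.ker φ with hW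
  have hWlt : Module.finrank ℝ W < Module.finrank ℝ V := by
    refine Submodule.finrank_lt fun h => ?_
    have : v₀ ∈ W := h ▸ Submodule.mem_top
    rw [hW, LinearMap.mem_ker, hφ] at this
    exact one_ne_zero this
  let π : V →ₗ[ℝ] W := LinearMap.codRestrict W (LinearMap.id - φ.smulRight v₀) (fun v => by
    simp [hW, hφ])
  have hπ : ∀ v, v = φ v • v₀ + (π v : V) := fun v => by
    change v = φ v • v₀ + (v - φ v • v₀)
    abel
  set B := QuadraticMap.associated (R := ℝ) Q with hB
  have hadd : ∀ a b, Q (a + b) = Q a + 2 * B a b + Q b := map_add_eq_associated Q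
  set c : ℝ := Q (0, v₀) with hc
  have hc0 : 0 ≤ c := by simpa using hQ 0 1 v₀
  let ν : V × V →ₗ[ℝ] ℝ := B (v₀, 0) ∘ₗ LinearMap.inr ℝ V V ∘ₗ LinearMap.fst ℝ V V
    + B (0, v₀) ∘ₗ LinearMap.inl ℝ V V ∘ₗ LinearMap.fst ℝ V V
    + B (0, v₀) ∘ₗ LinearMap.inr ℝ V V ∘ₗ LinearMap.snd ℝ V V
  have hν : ∀ p q, ν (p, q) = B (v₀, 0) (0, p) + B (0, v₀) (p, 0) + B (0, v₀) (0, q) :=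
    fun p q => rfl
  have hB1 : B (v₀, 0) (0, v₀) = 0 := associated_eq_zero_of_nonneg_line hz fun t => by
    simpa using hQ 1 t v₀
  have hB2 : ∀ w, B (v₀, 0) (w, 0) = 0 := fun w => associated_eq_zero_of_nonneg_line hz fun t => by
    simpa using hQ 1 0 (v₀ + t • w)
  -- the form in the coordinates `v = r • v₀ + w`; there is no term in `s ^ 2 * r ^ 2`, since
  -- `(1, 0) ⊗ v₀` is a zero, nor in `s * t * r ^ 2` or `s ^ 2 * r`, since it is a critical point
  have key : ∀ (s t r : ℝ) (w : V), Q (s • (r • v₀ + w), t • (r • v₀ + w)) =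
      c * t ^ 2 * r ^ 2 + 2 * r * t * ν (s • w, t • w) + Q (s • w, t • w) := by
    intro s t r w
    have e : (s • (r • v₀ + w), t • (r • v₀ + w)) =
        r • (s • (v₀, (0 : V)) + t • ((0 : V), v₀)) + (s • w, t • w) := by
      ext <;> simp [smul_smul, mul_comm]
    have e2 : (s • w, t • w) = s • (w, (0 : V)) + t • ((0 : V), w) := by
      ext <;> simp
    have e3 : ν (s • w, t • w) = s * B (v₀, 0) (0, w) + s * B (0, v₀) (w, 0)
        + t * B (0, v₀) (0, w) := by
      have h1 : ((0 : V), s • w) = s • ((0 : V), w) := by ext <;> simp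
      have h2 : (s • w, (0 : V)) = s • (w, (0 : V)) := by ext <;> simp
      have h3 : ((0 : V), t • w) = t • ((0 : V), w) := by ext <;> simp
      rw [hν, h1, h2, h3]
      simp only [map_smul, smul_eq_mul]
    have e4 : B (r • (s • (v₀, (0 : V)) + t • ((0 : V), v₀))) (s • w, t • w) =
        r * t * ν (s • w, t • w) := by
      rw [e3, e2]
      simp only [map_smul, map_add, LinearMap.smul_apply, LinearMap.add_apply, smul_eq_mul, hB2]
      ring
    have e5 : Q (r • (s • (v₀, (0 : V)) + t • ((0 : V), v₀))) = c * t ^ 2 * r ^ 2 := by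
      rw [QuadraticMap.map_smul, hadd, QuadraticMap.map_smul, QuadraticMap.map_smul]
      simp only [map_smul, LinearMap.smul_apply, hB1, hz, smul_eq_mul, hc]
      ring
    rw [e, hadd, e4, e5]
    ring
  -- if `c = 0`, the form is affine in `r`; the junk value `c⁻¹ = 0` then fits the formulas below
  have hν0 : c = 0 → ∀ (s t : ℝ) (w : V), t ≠ 0 → ν (s • w, t • w) = 0 := by
    intro h s t w ht
    by_contra hne
    have := hQ s t ((-(Q (s • w, t • w) + 1) / (2 * t * ν (s • w, t • w))) • v₀ + w)
    have e : -(Q (s • w, t • w) + 1) / (2 * t * ν (s • w, t • w)) * (2 * t * ν (s • w, t • w)) =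
        -(Q (s • w, t • w) + 1) := div_mul_cancel₀ _ (by positivity)
    rw [key, h] at this
    linarith
  -- for `t ≠ 0` minimise over `r`; the case `t = 0` follows by continuity
  have hdiff : ∀ (s t : ℝ) (w : V), 0 ≤ Q (s • w, t • w) - c⁻¹ * (ν (s • w, t • w)) ^ 2 := by
    have hne : ∀ (s t : ℝ) (w : V), t ≠ 0 →
        0 ≤ Q (s • w, t • w) - c⁻¹ * (ν (s • w, t • w)) ^ 2 := by
      intro s t w ht
      rcases hc0.eq_or_lt with h | h
      · rw [hν0 h.symm s t w ht]
        simpa using hQ s t w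
      · have := hQ s t ((-ν (s • w, t • w) / (c * t)) • v₀ + w)
        rw [key] at this
        field_simp at this ⊢
        linarith
    intro s t w
    by_cases ht : t = 0
    · subst ht
      let Q' : QuadraticForm ℝ (V × V) := Q - c⁻¹ • QuadraticMap.linMulLin ν ν
      have hQ' : ∀ z, Q' z = Q z - c⁻¹ * (ν z) ^ 2 := fun z => by simp [Q', sq]
      rw [← hQ']
      refine nonneg_of_quadratic_nonneg_of_ne_zero (a := Q' (s • w, (0 : ℝ) • w))
        (b := 2 * QuadraticMap.associated (R := ℝ) Q' (s • w, (0 : ℝ) • w) (0, w))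
        (c := Q' (0, w)) fun t ht => ?_
      have h := hne s t w ht
      have e : (s • w, t • w) = (s • w, (0 : ℝ) • w) + t • ((0 : V), w) := by ext <;> simp
      rw [← hQ', e, map_add_smul_eq_associated] at h
      linarith
    · exact hne s t w ht
  let ι : W × W →ₗ[ℝ] V × V := LinearMap.prodMap W.subtype W.subtype
  obtain ⟨g, hg, hgQ⟩ := ih W hWlt
    (Q.comp ι - c⁻¹ • QuadraticMap.linMulLin (ν ∘ₗ ι) (ν ∘ₗ ι)) (fun s t w => by
      have := hdiff s t (w : V)
      simpa [ι, sq] using this)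
  let L : V × V →ₗ[ℝ] ℝ := φ ∘ₗ LinearMap.snd ℝ V V + c⁻¹ • (ν ∘ₗ ι ∘ₗ LinearMap.prodMap π π)
  refine ⟨c • QuadraticMap.linMulLin L L + g.comp (LinearMap.prodMap π π), fun z => ?_,
    fun s t v => ?_⟩
  · have h1 := mul_nonneg hc0 (mul_self_nonneg (L z))
    simpa using add_nonneg h1 (hg _)
  · have h1 : g (LinearMap.prodMap π π (s • v, t • v)) =
        Q (s • (π v : V), t • (π v : V)) - c⁻¹ * (ν (s • (π v : V), t • (π v : V))) ^ 2 := by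
      have := hgQ s t (π v)
      simpa [ι, sq] using this
    have h2 : L (s • v, t • v) = t * φ v + c⁻¹ * ν (s • (π v : V), t • (π v : V)) := by
      simp [L, ι]
    have h3 := key s t (φ v) (π v)
    rw [← hπ] at h3
    rw [_root_.add_apply, QuadraticMap.comp_apply, h1, _root_.smul_apply,
      QuadraticMap.linMulLin_apply, h2, h3]
    rcases hc0.eq_or_lt with h | h
    · have h4 : t * ν (s • (π v : V), t • (π v : V)) = 0 := by
        by_cases ht : t = 0
        · rw [ht, zero_mul]
        · rw [hν0 h.symm s t _ ht, mul_zero]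
      rw [← h]
      simp only [_root_.inv_zero, zero_smul]
      linear_combination -2 * φ v * h4
    · rw [smul_eq_mul]
      field_simp
      ring

theorem continuous_quadraticForm {E : Type*} [NormedAddCommGroup E] [NormedSpace ℝ E]
    [FiniteDimensional ℝ E] (Q : QuadraticForm ℝ E) : Continuous Q := by
  have h : Continuous fun v =>
      (QuadraticMap.associated (R := ℝ) Q).toContinuousBilinearMap v v := by
    fun_prop
  simpa only [LinearMap.toContinuousBilinearMap_apply, associated_self] using h

/-- A biquadratic form on `ℝ² × V`, for `V ≠ 0`, becomes nonnegative with a nontrivial zero after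
subtracting a suitable multiple of `|x|² |v|²`. -/
theorem exists_sub_has_zero [FiniteDimensional ℝ V] [Nontrivial V]
    (Q : QuadraticForm ℝ (V × V)) (hQ : ∀ (s t : ℝ) (v : V), 0 ≤ Q (s • v, t • v)) :
    ∃ (m : ℝ) (N : QuadraticForm ℝ (V × V)) (s₀ t₀ : ℝ) (v₀ : V), 0 ≤ m ∧ (∀ z, 0 ≤ N z) ∧
      s₀ ^ 2 + t₀ ^ 2 = 1 ∧ v₀ ≠ 0 ∧ (Q - m • N) (s₀ • v₀, t₀ • v₀) = 0 ∧
      ∀ (s t : ℝ) (v : V), 0 ≤ (Q - m • N) (s • v, t • v) := by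
  set n := Module.finrank ℝ V with hn
  let E := EuclideanSpace ℝ (Fin n)
  have hfr : Module.finrank ℝ V = Module.finrank ℝ E := by simp [E, ← hn]
  let e : V ≃ₗ[ℝ] E := LinearEquiv.ofFinrankEq V E hfr
  have : Nontrivial E := e.symm.toEquiv.nontrivial
  let nE : QuadraticForm ℝ E := LinearMap.BilinMap.toQuadraticMap (innerₗ E)
  have hnE : ∀ u, nE u = ‖u‖ ^ 2 := fun u => by simp [nE]
  let N : QuadraticForm ℝ (V × V) := (nE.comp e.toLinearMap).comp (LinearMap.fst ℝ V V) +
    (nE.comp e.toLinearMap).comp (LinearMap.snd ℝ V V)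
  have hN : ∀ p q, N (p, q) = ‖e p‖ ^ 2 + ‖e q‖ ^ 2 := fun p q => by simp [N, hnE]
  have hN' : ∀ (s t : ℝ) v, N (s • v, t • v) = (s ^ 2 + t ^ 2) * ‖e v‖ ^ 2 := fun s t v => by
    rw [hN, map_smul, map_smul, norm_smul, norm_smul, mul_pow, mul_pow, Real.norm_eq_abs,
      Real.norm_eq_abs, sq_abs, sq_abs]
    ring
  let F : EuclideanSpace ℝ (Fin 2) × E → ℝ := fun z =>
    (Q.comp (LinearMap.prodMap e.symm.toLinearMap e.symm.toLinearMap)) (z.1 0 • z.2, z.1 1 • z.2)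
  have hF : ∀ z, F z = Q (z.1 0 • e.symm z.2, z.1 1 • e.symm z.2) := fun z => by simp [F]
  have hFc : Continuous F := by
    refine (continuous_quadraticForm _).comp ?_
    fun_prop
  have hK : IsCompact (Metric.sphere (0 : EuclideanSpace ℝ (Fin 2)) 1 ×ˢ Metric.sphere (0 : E) 1) :=
    (isCompact_sphere _ _).prod (isCompact_sphere _ _)
  have hKne : (Metric.sphere (0 : EuclideanSpace ℝ (Fin 2)) 1 ×ˢ
      Metric.sphere (0 : E) 1).Nonempty :=
    ((NormedSpace.sphere_nonempty).2 zero_le_one).prod ((NormedSpace.sphere_nonempty).2 zero_le_one)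
  obtain ⟨⟨x₀, u₀⟩, ⟨hx₀, hu₀⟩, hmin⟩ := hK.exists_isMinOn hKne hFc.continuousOn
  replace hx₀ : ‖x₀‖ = 1 := mem_sphere_zero_iff_norm.1 hx₀
  replace hu₀ : ‖u₀‖ = 1 := mem_sphere_zero_iff_norm.1 hu₀
  have hx₀' : x₀ 0 ^ 2 + x₀ 1 ^ 2 = 1 := by
    have := EuclideanSpace.real_norm_sq_eq x₀
    rw [hx₀, Fin.sum_univ_two] at this
    linarith
  -- the multiple is the minimum over the product of the unit spheres
  refine ⟨F (x₀, u₀), N, x₀ 0, x₀ 1, e.symm u₀, ?_, ?_, hx₀', ?_, ?_, ?_⟩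
  · rw [hF]
    exact hQ _ _ _
  · rintro ⟨p, q⟩
    rw [hN]
    positivity
  · intro h
    rw [LinearEquiv.map_eq_zero_iff] at h
    rw [h, norm_zero] at hu₀
    exact zero_ne_one hu₀
  · rw [_root_.sub_apply, _root_.smul_apply, hN', hx₀', LinearEquiv.apply_symm_apply, hu₀, hF]
    simp
  · intro s t v
    rw [_root_.sub_apply, _root_.smul_apply, hN', smul_eq_mul]
    by_cases hv : v = 0
    · simpa [hv] using hQ 0 0 v
    by_cases hst : s ^ 2 + t ^ 2 = 0
    · have hs : s = 0 := by nlinarith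
      have ht : t = 0 := by nlinarith
      simpa [hs, ht] using hQ 0 0 v
    set r := Real.sqrt (s ^ 2 + t ^ 2) with hr
    have hr2 : r ^ 2 = s ^ 2 + t ^ 2 := Real.sq_sqrt (by positivity)
    have hr0 : r ≠ 0 := fun h => hst (by rw [← hr2, h]; ring)
    have hev : ‖e v‖ ≠ 0 := norm_ne_zero_iff.2 (e.map_ne_zero_iff.2 hv)
    have h1 := hmin (a := (!₂[s / r, t / r], ‖e v‖⁻¹ • e v)) (by
      constructor
      · rw [mem_sphere_iff_norm, sub_zero, ← sq_eq_sq₀ (norm_nonneg _) zero_le_one,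
          EuclideanSpace.real_norm_sq_eq, Fin.sum_univ_two]
        simp only [Matrix.cons_val_zero, Matrix.cons_val_one, div_pow, hr2]
        field_simp
      · rw [mem_sphere_iff_norm, sub_zero, norm_smul, norm_inv, norm_norm, inv_mul_cancel₀ hev])
    have h2 : F (!₂[s / r, t / r], ‖e v‖⁻¹ • e v) = (r * ‖e v‖)⁻¹ ^ 2 * Q (s • v, t • v) := by
      rw [hF, sq, ← smul_eq_mul _ (Q _), ← QuadraticMap.map_smul]
      congr 1
      ext
      · simp [smul_smul]
        congr 1
        field_simp
      · simp [smul_smul]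
        congr 1
        field_simp
    have h3 : F (x₀, u₀) ≤ (r * ‖e v‖)⁻¹ ^ 2 * Q (s • v, t • v) := by
      rw [← h2]
      exact h1
    have h4 := mul_le_mul_of_nonneg_left h3 (sq_nonneg (r * ‖e v‖))
    have h5 : (r * ‖e v‖) ^ 2 * ((r * ‖e v‖)⁻¹ ^ 2 * Q (s • v, t • v)) = Q (s • v, t • v) := by
      field_simp
    rw [h5, mul_pow, hr2] at h4
    linarith

/-- Calderón's theorem: a nonnegative biquadratic form on `ℝ² × V` is the restriction to
rank-one tensors of a positive semidefinite quadratic form on `ℝ² ⊗ V = V × V`. -/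
theorem exists_posSemidef_rep_two (n : ℕ) : ∀ (V : Type u) [AddCommGroup V] [Module ℝ V]
    [FiniteDimensional ℝ V], Module.finrank ℝ V = n → ∀ Q : QuadraticForm ℝ (V × V),
      (∀ (s t : ℝ) (v : V), 0 ≤ Q (s • v, t • v)) →
      ∃ g : QuadraticForm ℝ (V × V), (∀ z, 0 ≤ g z) ∧
        ∀ (s t : ℝ) (v : V), g (s • v, t • v) = Q (s • v, t • v) := by
  induction n using Nat.strong_induction_on with
  | _ n ih =>
    intro V _ _ _ hn Q hQ
    rcases subsingleton_or_nontrivial V with hV | hV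
    · exact ⟨0, fun z => le_rfl, fun s t v => by
        rw [Subsingleton.elim (s • v, t • v) 0, QuadraticMap.map_zero, QuadraticMap.map_zero]⟩
    obtain ⟨m, N, s₀, t₀, v₀, hm, hN, hst, hv₀, hz, hnn⟩ := exists_sub_has_zero Q hQ
    let fst' := LinearMap.fst ℝ V V
    let snd' := LinearMap.snd ℝ V V
    -- a rotation of `ℝ²` moves the zero to `(1, 0) ⊗ v₀`
    let R : V × V →ₗ[ℝ] V × V := (s₀ • fst' - t₀ • snd').prod (t₀ • fst' + s₀ • snd')
    let R' : V × V →ₗ[ℝ] V × V := (s₀ • fst' + t₀ • snd').prod (s₀ • snd' - t₀ • fst')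
    have hR : ∀ s t v, R (s • v, t • v) = ((s₀ * s - t₀ * t) • v, (t₀ * s + s₀ * t) • v) :=
      fun s t v => by simp [R, fst', snd', smul_smul, sub_smul, add_smul]
    have hR' : ∀ s t v, R' (s • v, t • v) = ((s₀ * s + t₀ * t) • v, (s₀ * t - t₀ * s) • v) :=
      fun s t v => by simp [R', fst', snd', smul_smul, sub_smul, add_smul]
    obtain ⟨g, hg, hgQ⟩ := exists_posSemidef_rep_of_zero
      (fun W hW Q hQ => ih _ (hn ▸ hW) W rfl Q hQ) ((Q - m • N).comp R)
      (fun s t v => by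
        rw [QuadraticMap.comp_apply, hR]
        exact hnn _ _ _) hv₀ (by
        have := hR 1 0 v₀
        simp only [one_smul, zero_smul, mul_one, mul_zero, sub_zero, add_zero] at this
        rw [QuadraticMap.comp_apply, this, hz])
    refine ⟨g.comp R' + m • N, fun z => ?_, fun s t v => ?_⟩
    · have := mul_nonneg hm (hN z)
      simpa using add_nonneg (hg (R' z)) this
    · have e1 : s₀ * (s₀ * s + t₀ * t) - t₀ * (s₀ * t - t₀ * s) = s := by
        linear_combination s * hst
      have e2 : t₀ * (s₀ * s + t₀ * t) + s₀ * (s₀ * t - t₀ * s) = t := by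
        linear_combination t * hst
      rw [_root_.add_apply, QuadraticMap.comp_apply, hR', hgQ, QuadraticMap.comp_apply, hR, e1, e2]
      simp

end TwoByN

/-! ### Coefficients of the biquadratic form and criticality at zeros -/

section Coefficients

/-- The coefficient of `x i * x k * y j * y l` in the biquadratic form `f (x ⊗ y)`, symmetrised in
`i, k` and in `j, l`. -/
noncomputable def biCoeff (f : QuadraticForm ℝ Mat3) (i k j l : Fin 3) : ℝ :=
  (gram f i j k l + gram f i l k j) / 2

theorem biCoeff_swap_left (f : QuadraticForm ℝ Mat3) (i k j l : Fin 3) :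
    biCoeff f i k j l = biCoeff f k i j l := by
  unfold biCoeff
  rw [gram_comm f i j k l, gram_comm f i l k j, add_comm]

theorem biCoeff_swap_right (f : QuadraticForm ℝ Mat3) (i k j l : Fin 3) :
    biCoeff f i k j l = biCoeff f i k l j := by
  unfold biCoeff
  rw [add_comm]

theorem associated_left_eq_sum (f : QuadraticForm ℝ Mat3) (x x' y : Fin 3 → ℝ) :
    QuadraticMap.associated (R := ℝ) f (vecMulVec x y) (vecMulVec x' y) =
      ∑ i, ∑ k, ∑ j, ∑ l, x i * x' k * y j * y l * biCoeff f i k j l := by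
  rw [associated_eq_sum_gram]
  refine Finset.sum_congr rfl fun i _ => ?_
  rw [Finset.sum_comm]
  refine Finset.sum_congr rfl fun k _ => ?_
  have h : ∑ j, ∑ l, x i * x' k * y j * y l * gram f i l k j =
      ∑ j, ∑ l, x i * x' k * y j * y l * gram f i j k l := by
    rw [Finset.sum_comm]
    refine Finset.sum_congr rfl fun j _ => Finset.sum_congr rfl fun l _ => ?_
    ring
  have h2 : ∑ j, ∑ l, x i * x' k * y j * y l * biCoeff f i k j l =
      ((∑ j, ∑ l, x i * x' k * y j * y l * gram f i j k l) +
      ∑ j, ∑ l, x i * x' k * y j * y l * gram f i l k j) / 2 := by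
    rw [← Finset.sum_add_distrib, Finset.sum_div]
    refine Finset.sum_congr rfl fun j _ => ?_
    rw [← Finset.sum_add_distrib, Finset.sum_div]
    refine Finset.sum_congr rfl fun l _ => ?_
    unfold biCoeff
    ring
  rw [h2, h]
  simp only [vecMulVec_apply, add_self_div_two]
  refine Finset.sum_congr rfl fun j _ => Finset.sum_congr rfl fun l _ => ?_
  ring

theorem associated_right_eq_sum (f : QuadraticForm ℝ Mat3) (x y y' : Fin 3 → ℝ) :
    QuadraticMap.associated (R := ℝ) f (vecMulVec x y) (vecMulVec x y') =
      ∑ i, ∑ k, ∑ j, ∑ l, x i * x k * y j * y' l * biCoeff f i k j l := by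
  have h2 : ∀ i k j l : Fin 3, biCoeff f i k j l = (gram f i j k l + gram f k j i l) / 2 :=
    fun i k j l => by
      unfold biCoeff
      rw [gram_comm f i l k j]
  have h : ∑ i, ∑ k, ∑ j, ∑ l, x i * x k * y j * y' l * gram f k j i l =
      ∑ i, ∑ k, ∑ j, ∑ l, x i * x k * y j * y' l * gram f i j k l := by
    rw [Finset.sum_comm]
    refine Finset.sum_congr rfl fun i _ => Finset.sum_congr rfl fun k _ => ?_
    refine Finset.sum_congr rfl fun j _ => Finset.sum_congr rfl fun l _ => ?_
    ring
  have h3 : ∑ i, ∑ k, ∑ j, ∑ l, x i * x k * y j * y' l * biCoeff f i k j l =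
      ((∑ i, ∑ k, ∑ j, ∑ l, x i * x k * y j * y' l * gram f i j k l) +
      ∑ i, ∑ k, ∑ j, ∑ l, x i * x k * y j * y' l * gram f k j i l) / 2 := by
    simp only [← Finset.sum_add_distrib, Finset.sum_div, h2]
    refine Finset.sum_congr rfl fun i _ => Finset.sum_congr rfl fun k _ => ?_
    refine Finset.sum_congr rfl fun j _ => Finset.sum_congr rfl fun l _ => ?_
    ring
  rw [h3, h, add_self_div_two, associated_eq_sum_gram]
  refine Finset.sum_congr rfl fun i _ => ?_
  rw [Finset.sum_comm]
  refine Finset.sum_congr rfl fun k _ => Finset.sum_congr rfl fun j _ =>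
    Finset.sum_congr rfl fun l _ => ?_
  simp only [vecMulVec_apply]
  ring

theorem apply_vecMulVec_eq (f : QuadraticForm ℝ Mat3) (x y : Fin 3 → ℝ) :
    f (vecMulVec x y) =
      ∑ i, ∑ k, ∑ j, ∑ l, x i * x k * y j * y l * biCoeff f i k j l := by
  rw [← associated_self, associated_left_eq_sum]

/-- At a zero `(x, y)`, the derivative of `f (x ⊗ y)` in `x` vanishes. -/
theorem sum_biCoeff_left_eq_zero {f : QuadraticForm ℝ Mat3} (hf : IsNonnegOnRankOne f)
    {x y : Fin 3 → ℝ} (h : f (vecMulVec x y) = 0) (k : Fin 3) :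
    ∑ i, ∑ j, ∑ l, x i * y j * y l * biCoeff f i k j l = 0 := by
  have h1 := associated_left_eq_zero hf h (Pi.single k 1)
  rw [associated_left_eq_sum] at h1
  rw [← h1]
  refine Finset.sum_congr rfl fun i _ => ?_
  refine ((Finset.sum_eq_single k ?_ ?_).trans ?_).symm
  · intro b _ hb
    simp [hb]
  · simp
  · simp

/-- At a zero `(x, y)`, the derivative of `f (x ⊗ y)` in `y` vanishes. -/
theorem sum_biCoeff_right_eq_zero {f : QuadraticForm ℝ Mat3} (hf : IsNonnegOnRankOne f)
    {x y : Fin 3 → ℝ} (h : f (vecMulVec x y) = 0) (l : Fin 3) :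
    ∑ i, ∑ k, ∑ j, x i * x k * y j * biCoeff f i k j l = 0 := by
  have h1 := associated_right_eq_zero hf h (Pi.single l 1)
  rw [associated_right_eq_sum] at h1
  rw [← h1]
  refine Finset.sum_congr rfl fun i _ => Finset.sum_congr rfl fun k _ =>
    Finset.sum_congr rfl fun j _ => ?_
  refine ((Finset.sum_eq_single l ?_ ?_).trans ?_).symm
  · intro b _ hb
    simp [hb]
  · simp
  · simp

end Coefficients

/-! ### The S-lemma -/

section SLemma

variable {V : Type*} [AddCommGroup V] [Module ℝ V]

theorem sLemma_aux {Q N : QuadraticForm ℝ V} (h : ∀ v, N v = 0 → 0 ≤ Q v) {u v : V}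
    (hu : 0 < N u) (hv : N v < 0) : 0 ≤ Q u * -N v + Q v * N u := by
  set A := N u with hA
  obtain ⟨D, hD⟩ : ∃ D, D = -N v := ⟨_, rfl⟩
  have hD0 : 0 < D := by linarith
  set b := QuadraticMap.associated (R := ℝ) N u v with hb
  set C := QuadraticMap.associated (R := ℝ) Q u v with hC
  set r := Real.sqrt (b ^ 2 + A * D) with hr
  have hAD : 0 < A * D := mul_pos hu hD0
  have hr2 : r ^ 2 = b ^ 2 + A * D := Real.sq_sqrt (by positivity)
  have hr0 : 0 < r := Real.sqrt_pos.2 (by positivity)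
  -- the two zeros of `N` on the line `u + t v` have parameters `(b ± r) / D` of opposite signs
  have hroot : ∀ s : ℝ, s ^ 2 = b ^ 2 + A * D → 0 ≤ Q u * D ^ 2 + 2 * (b + s) * D * C
      + (b + s) ^ 2 * Q v := by
    intro s hs
    have h0 : N (u + ((b + s) / D) • v) = 0 := by
      rw [map_add_smul_eq_associated, ← hA, ← hb, show N v = -D by linarith]
      field_simp
      linear_combination -hs
    have h1 := h _ h0
    rw [map_add_smul_eq_associated, ← hC] at h1
    have h2 := mul_nonneg h1 (sq_nonneg D)
    field_simp at h2
    linarith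
  have h1 := hroot r hr2
  have h2 := hroot (-r) (by rw [neg_sq, hr2])
  have hlt : |b| < r := by
    rw [← Real.sqrt_sq_eq_abs]
    exact Real.sqrt_lt_sqrt (sq_nonneg _) (by linarith)
  have hb1 := abs_lt.1 hlt
  have h3 := add_nonneg (mul_nonneg (by linarith [hb1.2] : 0 ≤ r - b) h1)
    (mul_nonneg (by linarith [hb1.1] : 0 ≤ b + r) h2)
  have h4 : (r - b) * (Q u * D ^ 2 + 2 * (b + r) * D * C + (b + r) ^ 2 * Q v) +
      (b + r) * (Q u * D ^ 2 + 2 * (b + -r) * D * C + (b + -r) ^ 2 * Q v) =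
      (2 * r * D) * (Q u * D + Q v * A) := by
    linear_combination (2 * r * Q v) * hr2
  rw [h4] at h3
  rw [← hD]
  exact nonneg_of_mul_nonneg_right h3 (by positivity)

/-- The homogeneous S-lemma: a quadratic form that is nonnegative on the zero set of an indefinite
quadratic form `N` becomes nonnegative after adding a multiple of `N`. -/
theorem exists_add_smul_nonneg {Q N : QuadraticForm ℝ V} (h : ∀ v, N v = 0 → 0 ≤ Q v)
    (hpos : ∃ u, 0 < N u) (hneg : ∃ v, N v < 0) : ∃ c : ℝ, ∀ v, 0 ≤ (Q + c • N) v := by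
  obtain ⟨u₀, hu₀⟩ := hpos
  obtain ⟨v₀, hv₀⟩ := hneg
  set S : Set ℝ := {r | ∃ u, 0 < N u ∧ r = -Q u / N u} with hS
  have hle : ∀ v, N v < 0 → ∀ r ∈ S, r ≤ Q v / -N v := by
    rintro v hv r ⟨u, hu, rfl⟩
    rw [div_le_div_iff₀ hu (by linarith)]
    linarith [sLemma_aux h hu hv]
  have hbdd : BddAbove S := ⟨_, hle v₀ hv₀⟩
  have hne : S.Nonempty := ⟨_, u₀, hu₀, rfl⟩
  refine ⟨sSup S, fun v => ?_⟩
  rw [_root_.add_apply, _root_.smul_apply, smul_eq_mul]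
  rcases lt_trichotomy (N v) 0 with hv | hv | hv
  · have h1 := csSup_le hne (hle v hv)
    rw [le_div_iff₀ (by linarith)] at h1
    linarith
  · rw [hv, mul_zero, add_zero]
    exact h v hv
  · have h1 := le_csSup hbdd ⟨v, hv, rfl⟩
    rw [div_le_iff₀ hv] at h1
    linarith

end SLemma

/-! ### Forms that vanish along a curve of low degree -/

section ZeroCurves

/-- The quadratic form `z ↦ ∑ A i j * z i * z j`. -/
noncomputable def formOfMatrix {n : ℕ} (A : Matrix (Fin n) (Fin n) ℝ) :
    QuadraticForm ℝ (Fin n → ℝ) :=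
  ∑ i, ∑ j, A i j • QuadraticMap.linMulLin (LinearMap.proj i) (LinearMap.proj j)

theorem formOfMatrix_apply {n : ℕ} (A : Matrix (Fin n) (Fin n) ℝ) (z : Fin n → ℝ) :
    formOfMatrix A z = ∑ i, ∑ j, A i j * (z i * z j) := by
  simp [formOfMatrix]

theorem nonneg_of_line {V : Type*} [AddCommGroup V] [Module ℝ V] {Q : QuadraticForm ℝ V} {a b : V}
    (h : ∀ t : ℝ, t ≠ 0 → 0 ≤ Q (a + t • b)) : 0 ≤ Q a := by
  refine nonneg_of_quadratic_nonneg_of_ne_zero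
    (b := 2 * QuadraticMap.associated (R := ℝ) Q a b) (c := Q b) fun t ht => ?_
  have := h t ht
  rw [map_add_smul_eq_associated] at this
  linarith

/-- A form that vanishes at `e₀ ⊗ y` for all `y` in a plane: complete the square in `x₀ y₂`, which
leaves a biquadratic form in `(x₁, x₂)` and `y`. -/
theorem hasPosSemidefRep_of_zero_line {f : QuadraticForm ℝ Mat3} (hf : IsNonnegOnRankOne f)
    (h : ∀ s t : ℝ, f (vecMulVec ![1, 0, 0] ![s, t, 0]) = 0) : HasPosSemidefRep f := by
  have hl := fun s t k => sum_biCoeff_left_eq_zero hf (h s t) k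
  have hr := fun s t k => sum_biCoeff_right_eq_zero hf (h s t) k
  simp only [Fin.sum_univ_three, cons_val_zero, cons_val_one, cons_val] at hl hr
  have sl := biCoeff_swap_left f
  have sr := biCoeff_swap_right f
  set m := biCoeff f with hm
  have z00 : ∀ k, m 0 k 0 0 = 0 := fun k => by simpa using hl 1 0 k
  have z11 : ∀ k, m 0 k 1 1 = 0 := fun k => by simpa using hl 0 1 k
  have z01 : ∀ k, m 0 k 0 1 = 0 := fun k => by
    have h1 := hl 1 1 k
    simp only [z00, z11, sr 0 k 1 0] at h1
    linarith
  have z02 : m 0 0 0 2 = 0 := by simpa using hr 1 0 2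
  have z12 : m 0 0 1 2 = 0 := by simpa using hr 0 1 2
  let R : (Fin 3 → ℝ) × (Fin 3 → ℝ) →ₗ[ℝ] Mat3 :=
    { toFun := fun p => Matrix.of ![0, p.1, p.2]
      map_add' := fun p q => by ext i j; fin_cases i <;> simp
      map_smul' := fun c p => by ext i j; fin_cases i <;> simp }
  have hR : ∀ (s t : ℝ) y, R (s • y, t • y) = vecMulVec ![0, s, t] y := fun s t y => by
    ext i j; fin_cases i <;> simp [R, vecMulVec_apply]
  let Q : QuadraticForm ℝ ((Fin 3 → ℝ) × (Fin 3 → ℝ)) := f.comp R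
  have hQ : ∀ (s t : ℝ) y, Q (s • y, t • y) = f (vecMulVec ![0, s, t] y) := fun s t y => by
    rw [← hR, QuadraticMap.comp_apply]
  let P : Fin 3 → (Fin 3 → ℝ) × (Fin 3 → ℝ) →ₗ[ℝ] ℝ :=
    fun j => LinearMap.proj j ∘ₗ LinearMap.fst ℝ _ _
  let P' : Fin 3 → (Fin 3 → ℝ) × (Fin 3 → ℝ) →ₗ[ℝ] ℝ :=
    fun j => LinearMap.proj j ∘ₗ LinearMap.snd ℝ _ _
  let μ : (Fin 3 → ℝ) × (Fin 3 → ℝ) →ₗ[ℝ] ℝ :=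
    (2 * m 0 1 0 2) • P 0 + (2 * m 0 1 1 2) • P 1 + m 0 1 2 2 • P 2
    + (2 * m 0 2 0 2) • P' 0 + (2 * m 0 2 1 2) • P' 1 + m 0 2 2 2 • P' 2
  have hμ : ∀ p, μ p = 2 * m 0 1 0 2 * p.1 0 + 2 * m 0 1 1 2 * p.1 1 + m 0 1 2 2 * p.1 2
      + 2 * m 0 2 0 2 * p.2 0 + 2 * m 0 2 1 2 * p.2 1 + m 0 2 2 2 * p.2 2 := fun p => rfl
  set a := m 0 0 2 2 with ha
  have key : ∀ x y, f (vecMulVec x y) = a * (x 0 * y 2) ^ 2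
      + 2 * (x 0 * y 2) * μ (x 1 • y, x 2 • y) + Q (x 1 • y, x 2 • y) := by
    intro x y
    rw [hQ, apply_vecMulVec_eq, apply_vecMulVec_eq, hμ]
    simp only [Fin.sum_univ_three, ← hm, cons_val_zero, cons_val_one, cons_val, Pi.smul_apply,
      smul_eq_mul]
    simp only [sl 1 0, sl 2 0, sr _ _ 1 0, sr _ _ 2 0, sr _ _ 2 1, z00, z11, z01, z02, z12]
    ring
  have ha0 : 0 ≤ a := by
    have := hf ![1, 0, 0] ![0, 0, 1]
    rw [key, hQ, apply_vecMulVec_eq] at this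
    simpa [hμ, Fin.sum_univ_three] using this
  -- if `a = 0`, the form is affine in `x 0`; the junk value `a⁻¹ = 0` then fits the formulas below
  have hμ0 : a = 0 → ∀ (s t : ℝ) y, y 2 ≠ 0 → μ (s • y, t • y) = 0 := by
    intro h0 s t y hy
    by_contra hne
    have e : -(Q (s • y, t • y) + 1) / (2 * y 2 * μ (s • y, t • y)) *
        (2 * y 2 * μ (s • y, t • y)) = -(Q (s • y, t • y) + 1) :=
      div_mul_cancel₀ _ (by positivity)
    have := hf ![-(Q (s • y, t • y) + 1) / (2 * y 2 * μ (s • y, t • y)), s, t] y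
    rw [key, h0] at this
    simp only [cons_val_zero, cons_val_one, cons_val] at this
    linarith
  let Q' : QuadraticForm ℝ ((Fin 3 → ℝ) × (Fin 3 → ℝ)) := Q - a⁻¹ • QuadraticMap.linMulLin μ μ
  have hQ' : ∀ p, Q' p = Q p - a⁻¹ * (μ p) ^ 2 := fun p => by simp [Q', sq]
  have hne : ∀ (s t : ℝ) (y : Fin 3 → ℝ), y 2 ≠ 0 → 0 ≤ Q' (s • y, t • y) := by
    intro s t y hy
    rw [hQ']
    rcases ha0.eq_or_lt with h0 | h0
    · rw [hμ0 h0.symm s t y hy, hQ]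
      simpa using hf ![0, s, t] y
    · have := hf ![-μ (s • y, t • y) / (a * y 2), s, t] y
      rw [key] at this
      simp only [cons_val_zero, cons_val_one, cons_val] at this
      field_simp at this ⊢
      linarith
  obtain ⟨g, hg, hgQ⟩ := exists_posSemidef_rep_two _ (Fin 3 → ℝ) rfl Q' (fun s t y => by
    by_cases hy : y 2 = 0
    · refine nonneg_of_line (b := (s • ![0, 0, 1], t • ![0, 0, 1])) fun r hr => ?_
      have := hne s t (y + r • ![0, 0, 1]) (by simpa [hy] using hr)
      have e : ∀ w : Fin 3 → ℝ, (s • y, t • y) + r • (s • w, t • w) =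
          (s • (y + r • w), t • (y + r • w)) := fun w => by
        refine Prod.ext ?_ ?_
        · simp only [Prod.fst_add, Prod.smul_fst]
          module
        · simp only [Prod.snd_add, Prod.smul_snd]
          module
      rwa [e]
    · exact hne s t y hy)
  let rows : Mat3 →ₗ[ℝ] (Fin 3 → ℝ) × (Fin 3 → ℝ) :=
    { toFun := fun ξ => (ξ 1, ξ 2)
      map_add' := fun _ _ => rfl
      map_smul' := fun _ _ => rfl }
  have hrows : ∀ x y, rows (vecMulVec x y) = (x 1 • y, x 2 • y) := fun x y => rfl
  let L : Mat3 →ₗ[ℝ] ℝ := Matrix.entryLinearMap ℝ ℝ 0 2 + a⁻¹ • (μ ∘ₗ rows)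
  refine ⟨a • QuadraticMap.linMulLin L L + g.comp rows, fun ξ => ?_, fun x y => ?_⟩
  · have h1 := mul_nonneg ha0 (mul_self_nonneg (L ξ))
    simpa using add_nonneg h1 (hg _)
  · have hL : L (vecMulVec x y) = x 0 * y 2 + a⁻¹ * μ (x 1 • y, x 2 • y) := rfl
    rw [_root_.add_apply, QuadraticMap.comp_apply, _root_.smul_apply, hrows, hgQ, hQ',
      QuadraticMap.linMulLin_apply, hL, key, smul_eq_mul]
    rcases ha0.eq_or_lt with h0 | h0
    · have h4 : y 2 * μ (x 1 • y, x 2 • y) = 0 := by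
        by_cases hy : y 2 = 0
        · rw [hy, zero_mul]
        · rw [hμ0 h0.symm _ _ y hy, mul_zero]
      rw [← h0]
      simp only [_root_.inv_zero, zero_mul]
      linear_combination -2 * x 0 * h4
    · field_simp
      ring

/-- The values of the six quantities listed below are dense in a quadric of signature `(3, 3)`. -/
theorem nonneg_on_quadric {H : QuadraticForm ℝ (Fin 6 → ℝ)}
    (h : ∀ x y : Fin 3 → ℝ, 0 ≤ H ![x 0 * y 1 - x 1 * y 0, x 2 * y 0, x 2 * y 1, x 0 * y 2,
      x 1 * y 2, x 2 * y 2])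
    {z : Fin 6 → ℝ} (hz : z 0 * z 5 + z 1 * z 4 - z 2 * z 3 = 0) : 0 ≤ H z := by
  have hval : ∀ x₀ x₁ x₂ y₀ y₁ y₂ : ℝ, ∀ z : Fin 6 → ℝ, x₀ * y₁ - x₁ * y₀ = z 0 →
      x₂ * y₀ = z 1 → x₂ * y₁ = z 2 → x₀ * y₂ = z 3 → x₁ * y₂ = z 4 → x₂ * y₂ = z 5 →
      0 ≤ H z := fun x₀ x₁ x₂ y₀ y₁ y₂ z h0 h1 h2 h3 h4 h5 => by
    have e : z = ![x₀ * y₁ - x₁ * y₀, x₂ * y₀, x₂ * y₁, x₀ * y₂, x₁ * y₂, x₂ * y₂] := by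
      rw [h0, h1, h2, h3, h4, h5]
      ext i
      fin_cases i <;> rfl
    rw [e]
    exact h ![x₀, x₁, x₂] ![y₀, y₁, y₂]
  have hne : ∀ z : Fin 6 → ℝ, z 0 * z 5 + z 1 * z 4 - z 2 * z 3 = 0 → z 5 ≠ 0 → 0 ≤ H z :=
    fun z hz h5 => by
      refine hval (z 3 / z 5) (z 4 / z 5) 1 (z 1) (z 2) (z 5) z ?_ (one_mul _) (one_mul _)
        (div_mul_cancel₀ _ h5) (div_mul_cancel₀ _ h5) (one_mul _)
      field_simp
      linarith
  by_cases h5 : z 5 = 0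
  swap
  · exact hne z hz h5
  rw [h5, mul_zero, zero_add] at hz
  by_cases ha : z 1 ^ 2 + z 2 ^ 2 = 0
  · have h1 : z 1 = 0 := by nlinarith [sq_nonneg (z 1), sq_nonneg (z 2)]
    have h2 : z 2 = 0 := by nlinarith [sq_nonneg (z 1), sq_nonneg (z 2)]
    by_cases hb : z 3 ^ 2 + z 4 ^ 2 = 0
    · have h3 : z 3 = 0 := by nlinarith [sq_nonneg (z 3), sq_nonneg (z 4)]
      have h4 : z 4 = 0 := by nlinarith [sq_nonneg (z 3), sq_nonneg (z 4)]
      refine hval (z 0) 0 0 0 1 0 z ?_ ?_ ?_ ?_ ?_ ?_ <;> simp [h1, h2, h3, h4, h5]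
    · refine hval (z 3) (z 4) 0 (-(z 0 * z 4) / (z 3 ^ 2 + z 4 ^ 2))
        (z 0 * z 3 / (z 3 ^ 2 + z 4 ^ 2)) 1 z ?_ ?_ ?_ (mul_one _) (mul_one _) ?_
      · field_simp
        ring
      · rw [h1, zero_mul]
      · rw [h2, zero_mul]
      · rw [h5, zero_mul]
  · -- move along a curve in the quadric on which the last coordinate is nonzero
    refine nonneg_of_line (b := ![0, 0, 0, z 0 * z 2 / (z 1 ^ 2 + z 2 ^ 2),
      -(z 0 * z 1) / (z 1 ^ 2 + z 2 ^ 2), 1]) fun t ht => hne _ ?_ ?_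
    · simp only [Pi.add_apply, Pi.smul_apply, smul_eq_mul, cons_val_zero, cons_val_one, cons_val,
        h5, mul_zero, mul_one, add_zero, zero_add]
      field_simp
      linear_combination (z 1 ^ 2 + z 2 ^ 2) * hz
    · simpa only [Pi.add_apply, Pi.smul_apply, smul_eq_mul, cons_val, h5, mul_one, zero_add]
        using ht

/-- The values of the five quantities listed below are dense in `ℝ⁵`. -/
theorem nonneg_of_nonneg_bilinear {H : QuadraticForm ℝ (Fin 5 → ℝ)}
    (h : ∀ x y : Fin 3 → ℝ, 0 ≤ H ![x 1 * y 0 - x 0 * y 1, x 2 * y 0 - x 1 * y 1, x 0 * y 2,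
      x 1 * y 2, x 2 * y 2])
    (z : Fin 5 → ℝ) : 0 ≤ H z := by
  have hne : ∀ z : Fin 5 → ℝ, z 2 * z 4 - z 3 ^ 2 ≠ 0 → 0 ≤ H z := fun z hz => by
    set D := z 2 * z 4 - z 3 ^ 2 with hD
    have hP : (z 2 * z 1 - z 3 * z 0) / D * D = z 2 * z 1 - z 3 * z 0 := div_mul_cancel₀ _ hz
    have hQ : (z 3 * z 1 - z 4 * z 0) / D * D = z 3 * z 1 - z 4 * z 0 := div_mul_cancel₀ _ hz
    set P := (z 2 * z 1 - z 3 * z 0) / D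
    set Q := (z 3 * z 1 - z 4 * z 0) / D
    have e0 : z 3 * P - z 2 * Q = z 0 := mul_right_cancel₀ hz (by
      linear_combination z 3 * hP - z 2 * hQ - z 0 * hD)
    have e1 : z 4 * P - z 3 * Q = z 1 := mul_right_cancel₀ hz (by
      linear_combination z 4 * hP - z 3 * hQ - z 1 * hD)
    have e : z = ![z 3 * P - z 2 * Q, z 4 * P - z 3 * Q, z 2 * 1, z 3 * 1, z 4 * 1] := by
      rw [e0, e1]
      ext i
      fin_cases i <;> simp
    rw [e]
    exact h ![z 2, z 3, z 4] ![P, Q, 1]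
  by_cases hz : z 2 * z 4 - z 3 ^ 2 = 0
  swap
  · exact hne z hz
  by_cases h4 : z 4 = 0
  · have h3 : z 3 = 0 := by
      rw [h4] at hz
      exact pow_eq_zero_iff two_ne_zero |>.1 (by linarith)
    by_cases h2 : z 2 = 0
    · refine nonneg_of_line (b := ![0, 0, 1, 0, 1]) fun t ht => hne _ ?_
      simpa [h2, h3, h4] using ht
    · refine nonneg_of_line (b := ![0, 0, 0, 0, 1]) fun t ht => hne _ ?_
      simpa [h3, h4] using ⟨h2, ht⟩
  · refine nonneg_of_line (b := ![0, 0, 1, 0, 0]) fun t ht => hne _ ?_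
    have h5 : t * z 4 ≠ 0 := mul_ne_zero ht h4
    have e : (z 2 + t) * z 4 - z 3 ^ 2 = t * z 4 := by linear_combination hz
    simpa [e] using h5

/-- A form that vanishes at `x ⊗ x` for all `x` in a plane is a quadratic form in the six
quantities `x₀ y₁ - x₁ y₀`, `x₂ y₀`, `x₂ y₁`, `x₀ y₂`, `x₁ y₂`, `x₂ y₂`, whose values are dense in
a quadric; the S-lemma applies. -/
theorem hasPosSemidefRep_of_zero_conic {f : QuadraticForm ℝ Mat3} (hf : IsNonnegOnRankOne f)
    (h : ∀ s t : ℝ, f (vecMulVec ![s, t, 0] ![s, t, 0]) = 0) : HasPosSemidefRep f := by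
  have hl := fun s t k => sum_biCoeff_left_eq_zero hf (h s t) k
  have hr := fun s t k => sum_biCoeff_right_eq_zero hf (h s t) k
  have sl := biCoeff_swap_left f
  have sr := biCoeff_swap_right f
  have hexp := apply_vecMulVec_eq f
  set m := biCoeff f with hm
  simp only [Fin.sum_univ_three, cons_val_zero, cons_val_one, cons_val, mul_zero, zero_mul,
    add_zero, sl 1 0, sl 2 0, sl 2 1, sr _ _ 1 0, sr _ _ 2 0, sr _ _ 2 1] at hl hr hexp
  -- the coefficients of the polynomials in `s`, `t` that express criticality along the curve
  have L : ∀ k, m 0 k 0 0 = 0 ∧ m 1 k 0 0 + 2 * m 0 k 0 1 = 0 ∧ m 0 k 1 1 + 2 * m 1 k 0 1 = 0 ∧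
      m 1 k 1 1 = 0 := fun k => by
    have h1 := hl 1 0 k
    have h2 := hl 0 1 k
    have h3 := hl 1 1 k
    have h4 := hl 1 (-1) k
    refine ⟨by linarith, by linarith, by linarith, by linarith⟩
  have R : ∀ l, m 0 0 0 l = 0 ∧ m 0 0 1 l + 2 * m 0 1 0 l = 0 ∧ m 1 1 0 l + 2 * m 0 1 1 l = 0 ∧
      m 1 1 1 l = 0 := fun l => by
    have h1 := hr 1 0 l
    have h2 := hr 0 1 l
    have h3 := hr 1 1 l
    have h4 := hr 1 (-1) l
    refine ⟨by linarith, by linarith, by linarith, by linarith⟩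
  obtain ⟨e1, -, e2, -⟩ := L 0
  obtain ⟨e3, e4, -, e5⟩ := L 1
  obtain ⟨e6, e7, e8, e9⟩ := L 2
  obtain ⟨d1, d2, d3, d4⟩ := R 2
  obtain ⟨d5, -, -, -⟩ := R 1
  obtain ⟨-, -, -, d8⟩ := R 0
  have e0 : m 0 1 1 1 = 0 := by rw [sl]; exact (L 0).2.2.2
  rw [sr] at d8
  rw [sl 1 0] at e2
  let H : QuadraticForm ℝ (Fin 6 → ℝ) := formOfMatrix
    !![m 0 0 1 1, 4 * m 0 2 0 1, -4 * m 1 2 0 1, -4 * m 0 1 0 2, 4 * m 0 1 1 2, 0;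
      0, m 2 2 0 0, 2 * m 2 2 0 1, 4 * m 0 2 0 2, 4 * m 1 2 0 2, 2 * m 2 2 0 2;
      0, 0, m 2 2 1 1, 4 * m 0 2 1 2, 4 * m 1 2 1 2, 2 * m 2 2 1 2;
      0, 0, 0, m 0 0 2 2, 2 * m 0 1 2 2, 2 * m 0 2 2 2;
      0, 0, 0, 0, m 1 1 2 2, 2 * m 1 2 2 2;
      0, 0, 0, 0, 0, m 2 2 2 2]
  let N : QuadraticForm ℝ (Fin 6 → ℝ) := formOfMatrix
    !![0, 0, 0, 0, 0, 1; 0, 0, 0, 0, 1, 0; 0, 0, 0, -1, 0, 0; 0, 0, 0, 0, 0, 0; 0, 0, 0, 0, 0, 0;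
      0, 0, 0, 0, 0, 0]
  have hN : ∀ z, N z = z 0 * z 5 + z 1 * z 4 - z 2 * z 3 := fun z => by
    simp [N, formOfMatrix_apply, Fin.sum_univ_six]
    ring
  let T : Mat3 →ₗ[ℝ] (Fin 6 → ℝ) :=
    { toFun := fun ξ => ![ξ 0 1 - ξ 1 0, ξ 2 0, ξ 2 1, ξ 0 2, ξ 1 2, ξ 2 2]
      map_add' := fun ξ η => by
        ext i; fin_cases i <;> simp
        ring
      map_smul' := fun c ξ => by
        ext i; fin_cases i <;> simp
        ring }
  have hT : ∀ x y, T (vecMulVec x y) =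
    ![x 0 * y 1 - x 1 * y 0, x 2 * y 0, x 2 * y 1, x 0 * y 2, x 1 * y 2, x 2 * y 2] :=
    fun x y => rfl
  have hNT : ∀ x y, N (T (vecMulVec x y)) = 0 := fun x y => by
    rw [hN, hT]
    simp only [cons_val_zero, cons_val_one, cons_val]
    ring
  have hHT : ∀ x y, H (T (vecMulVec x y)) = f (vecMulVec x y) := fun x y => by
    rw [hexp, hT]
    simp only [H, formOfMatrix_apply, Fin.sum_univ_six, of_apply, cons_val', cons_val_zero,
      cons_val_one, cons_val]
    linear_combination (-2 * x 0 * x 1 * y 1 ^ 2) * e0 - x 0 ^ 2 * y 0 ^ 2 * e1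
      + (x 1 ^ 2 * y 0 ^ 2 - 2 * x 0 * x 1 * y 0 * y 1) * e2 - 2 * x 0 * x 1 * y 0 ^ 2 * e3
      - x 1 ^ 2 * y 0 ^ 2 * e4 - x 1 ^ 2 * y 1 ^ 2 * e5 - 2 * x 0 * x 2 * y 0 ^ 2 * e6
      - 2 * x 1 * x 2 * y 0 ^ 2 * e7 - 2 * x 0 * x 2 * y 1 ^ 2 * e8 - 2 * x 1 * x 2 * y 1 ^ 2 * e9
      - 2 * x 0 ^ 2 * y 0 * y 2 * d1 - 2 * x 0 ^ 2 * y 1 * y 2 * d2 - 2 * x 1 ^ 2 * y 0 * y 2 * d3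
      - 2 * x 1 ^ 2 * y 1 * y 2 * d4 - 2 * x 0 ^ 2 * y 0 * y 1 * d5 - 2 * x 1 ^ 2 * y 0 * y 1 * d8
  have hH : ∀ z, N z = 0 → 0 ≤ H z := fun z hz => by
    refine nonneg_on_quadric (fun x y => ?_) (by rwa [hN] at hz)
    rw [← hT, hHT]
    exact hf x y
  obtain ⟨c, hc⟩ := exists_add_smul_nonneg hH ⟨![1, 0, 0, 0, 0, 1], by simp [hN]⟩
    ⟨![-1, 0, 0, 0, 0, 1], by simp [hN]⟩
  refine ⟨(H + c • N).comp T, fun ξ => hc _, fun x y => ?_⟩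
  rw [QuadraticMap.comp_apply, _root_.add_apply, _root_.smul_apply, hNT, hHT, smul_zero, add_zero]

/-- A form that vanishes at `x ⊗ y` along the twisted cubic `x = (s², s t, t²)`, `y = (s, t, 0)` is
a quadratic form in the five quantities `x₁ y₀ - x₀ y₁`, `x₂ y₀ - x₁ y₁`, `x₀ y₂`, `x₁ y₂`, `x₂ y₂`,
whose values are dense, so that this quadratic form is positive semidefinite. -/
theorem hasPosSemidefRep_of_zero_cubic {f : QuadraticForm ℝ Mat3} (hf : IsNonnegOnRankOne f)
    (h : ∀ s t : ℝ, f (vecMulVec ![s ^ 2, s * t, t ^ 2] ![s, t, 0]) = 0) :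
    HasPosSemidefRep f := by
  have hl := fun s t k => sum_biCoeff_left_eq_zero hf (h s t) k
  have hr := fun s t => sum_biCoeff_right_eq_zero hf (h s t) 2
  have sl := biCoeff_swap_left f
  have sr := biCoeff_swap_right f
  have hexp := apply_vecMulVec_eq f
  set m := biCoeff f with hm
  simp only [Fin.sum_univ_three, cons_val_zero, cons_val_one, cons_val, mul_zero, zero_mul,
    add_zero, sl 1 0, sl 2 0, sl 2 1, sr _ _ 1 0, sr _ _ 2 0, sr _ _ 2 1] at hl hr hexp
  -- the coefficients of the polynomials in `s`, `t` that express criticality along the curve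
  have L : ∀ k, m 0 k 0 0 = 0 ∧ m 1 k 0 0 + 2 * m 0 k 0 1 = 0 ∧
      m 2 k 0 0 + 2 * m 1 k 0 1 + m 0 k 1 1 = 0 ∧ 2 * m 2 k 0 1 + m 1 k 1 1 = 0 ∧
      m 2 k 1 1 = 0 := fun k => by
    have h1 := hl 1 0 k
    have h2 := hl 0 1 k
    have h3 := hl 1 1 k
    have h4 := hl 1 (-1) k
    have h5 := hl 1 2 k
    have h6 := hl 1 (-2) k
    refine ⟨by linarith, by linarith, by linarith, by linarith, by linarith⟩
  obtain ⟨e1, -, -, -, -⟩ := L 0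
  obtain ⟨e2, e3, e4, e5, e6⟩ := L 1
  obtain ⟨e7, e8, e9, e10, e11⟩ := L 2
  have e12 : 2 * m 0 1 0 1 + m 0 0 1 1 = 0 := by
    have := (L 0).2.2.1
    rw [sl 2 0, sl 1 0] at this
    linarith
  have e13 : m 0 0 0 1 = 0 := by
    have := (L 0).2.1
    rw [sl 1 0] at this
    linarith
  have e14 : 2 * m 0 2 0 1 + m 0 1 1 1 = 0 := by
    have := (L 0).2.2.2.1
    rw [sl 2 0, sl 1 0] at this
    linarith
  have e15 : m 0 2 1 1 = 0 := by
    have := (L 0).2.2.2.2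
    rwa [sl 2 0] at this
  rw [sl 2 1] at e4 e5 e6
  have R : m 0 0 0 2 = 0 ∧ 2 * m 0 1 0 2 + m 0 0 1 2 = 0 ∧
      2 * m 0 2 0 2 + m 1 1 0 2 + 2 * m 0 1 1 2 = 0 ∧
      2 * m 1 2 0 2 + 2 * m 0 2 1 2 + m 1 1 1 2 = 0 ∧ m 2 2 0 2 + 2 * m 1 2 1 2 = 0 ∧
      m 2 2 1 2 = 0 := by
    have h1 := hr 1 0
    have h2 := hr 0 1
    have h3 := hr 1 1
    have h4 := hr 1 (-1)
    have h5 := hr 1 2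
    have h6 := hr 1 (-2)
    refine ⟨by linarith, by linarith, by linarith, by linarith, by linarith, by linarith⟩
  obtain ⟨d1, d2, d3, d4, d5, d6⟩ := R
  have v1 : m 2 2 0 1 = 0 := by linarith
  have v2 : m 0 1 0 1 = -m 1 1 0 0 / 2 := by linarith
  have v3 : m 0 0 1 1 = m 1 1 0 0 := by linarith
  have v4 : m 0 2 0 1 = -m 1 2 0 0 / 2 := by linarith
  have v5 : m 0 1 1 1 = m 1 2 0 0 := by linarith
  have v6 : m 1 1 0 1 = -m 1 2 0 0 := by linarith
  have v7 : m 1 2 0 1 = -m 2 2 0 0 / 2 := by linarith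
  have v8 : m 1 1 1 1 = m 2 2 0 0 := by linarith
  have v9 : m 0 0 1 2 = -2 * m 0 1 0 2 := by linarith
  have v10 : m 0 1 1 2 = -m 0 2 0 2 - m 1 1 0 2 / 2 := by linarith
  have v11 : m 1 2 0 2 = -m 0 2 1 2 - m 1 1 1 2 / 2 := by linarith
  have v12 : m 1 2 1 2 = -m 2 2 0 2 / 2 := by linarith
  let H : QuadraticForm ℝ (Fin 5 → ℝ) := formOfMatrix
    !![m 1 1 0 0, 2 * m 1 2 0 0, 4 * m 0 1 0 2, 2 * m 1 1 0 2, -4 * m 0 2 1 2;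
      0, m 2 2 0 0, 4 * m 0 2 0 2, -2 * m 1 1 1 2, 2 * m 2 2 0 2;
      0, 0, m 0 0 2 2, 2 * m 0 1 2 2, 2 * m 0 2 2 2;
      0, 0, 0, m 1 1 2 2, 2 * m 1 2 2 2;
      0, 0, 0, 0, m 2 2 2 2]
  let T : Mat3 →ₗ[ℝ] (Fin 5 → ℝ) :=
    { toFun := fun ξ => ![ξ 1 0 - ξ 0 1, ξ 2 0 - ξ 1 1, ξ 0 2, ξ 1 2, ξ 2 2]
      map_add' := fun ξ η => by
        ext i; fin_cases i <;> simp <;> ring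
      map_smul' := fun c ξ => by
        ext i; fin_cases i <;> simp <;> ring }
  have hT : ∀ x y, T (vecMulVec x y) =
    ![x 1 * y 0 - x 0 * y 1, x 2 * y 0 - x 1 * y 1, x 0 * y 2, x 1 * y 2, x 2 * y 2] :=
    fun x y => rfl
  have hHT : ∀ x y, H (T (vecMulVec x y)) = f (vecMulVec x y) := fun x y => by
    rw [hexp, hT]
    simp only [H, formOfMatrix_apply, Fin.sum_univ_five, of_apply, cons_val', cons_val_zero,
      cons_val_one, cons_val]
    simp only [v1, v2, v3, v4, v5, v6, v7, v8, v9, v10, v11, v12, e1, e2, e6, e7, e11, e13, e15,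
      d1, d6]
    ring
  have hH : ∀ z, 0 ≤ H z := fun z => by
    refine nonneg_of_nonneg_bilinear (fun x y => ?_) z
    rw [← hT, hHT]
    exact hf x y
  refine ⟨H.comp T, fun ξ => hH _, fun x y => ?_⟩
  rw [QuadraticMap.comp_apply, hHT]

end ZeroCurves

/-! ### Kernels of singular pencils -/

section KernelPencil

variable {V : Type*} [AddCommGroup V] [Module ℝ V]

theorem linearIndependent_pair_of_mem {N : Submodule ℝ (V × V)}
    (h0 : ∀ x, (x, (0 : V)) ∈ N → ((0 : V), x) ∈ N → x = 0) {a b : V} (ha : (a, (0 : V)) ∈ N)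
    (hba : (b, a) ∈ N) (hb : ((0 : V), b) ∈ N) (hne : a ≠ 0 ∨ b ≠ 0) :
    LinearIndependent ℝ ![a, b] := by
  have ha0 : a ≠ 0 := by
    rintro rfl
    exact hne.elim (fun h => h rfl) fun h => h (h0 b hba hb)
  have hb0 : b ≠ 0 := by
    rintro rfl
    exact ha0 (h0 a ha hba)
  rw [LinearIndependent.pair_iff]
  intro s t hst
  have e : s • a = -(t • b) := eq_neg_of_add_eq_zero_left hst
  have h1 : s • a = 0 := by
    refine h0 _ ?_ ?_
    · simpa using N.smul_mem s ha
    · rw [e]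
      simpa using N.smul_mem (-t) hb
  rw [h1, zero_eq_neg] at e
  exact ⟨(smul_eq_zero.1 h1).resolve_right ha0, (smul_eq_zero.1 e).resolve_right hb0⟩

/-- The minimal polynomial curve in the kernel of a singular `3 × 3` pencil. If a subspace `N` of
`ℝ² ⊗ V`, with `dim V = 3`, contains some `(s, t) ⊗ x` with `x ≠ 0` for all `(s, t)`, then `x` can be
chosen to be a polynomial in `(s, t)` of degree `0`, `1` or `2`, with linearly independent
coefficients: `x`, `s • a + t • b` or `s ^ 2 • a + (s * t) • b + t ^ 2 • c`. -/
theorem exists_kernel_curve (hV : Module.finrank ℝ V = 3) {N : Submodule ℝ (V × V)}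
    (h : ∀ s t : ℝ, ∃ x : V, x ≠ 0 ∧ (s • x, t • x) ∈ N) :
    (∃ x : V, x ≠ 0 ∧ (x, (0 : V)) ∈ N ∧ ((0 : V), x) ∈ N) ∨
    (∃ a b : V, LinearIndependent ℝ ![a, b] ∧ (a, (0 : V)) ∈ N ∧ (b, a) ∈ N ∧ ((0 : V), b) ∈ N) ∨
    (∃ a b c : V, LinearIndependent ℝ ![a, b, c] ∧ (a, (0 : V)) ∈ N ∧ (b, a) ∈ N ∧ (c, b) ∈ N ∧
      ((0 : V), c) ∈ N) := by
  by_cases h0 : ∀ x, (x, (0 : V)) ∈ N → ((0 : V), x) ∈ N → x = 0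
  swap
  · left
    push Not at h0
    obtain ⟨x, h1, h2, h3⟩ := h0
    exact ⟨x, h3, h1, h2⟩
  right
  obtain ⟨a, ha0, ha⟩ := h 1 0
  obtain ⟨b, hb0, hb⟩ := h 0 1
  obtain ⟨c, hc0, hc⟩ := h 1 1
  obtain ⟨d, hd0, hd⟩ := h 1 2
  simp only [one_smul, zero_smul] at ha hb hc hd
  have mem : ∀ {p q p' q' : V}, (p, q) ∈ N → p = p' → q = q' → (p', q') ∈ N := by
    rintro p q p' q' hN rfl rfl
    exact hN
  have deg1 : ∀ a b : V, (a, (0 : V)) ∈ N → (b, a) ∈ N → ((0 : V), b) ∈ N → (a ≠ 0 ∨ b ≠ 0) →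
      ∃ a b : V, LinearIndependent ℝ ![a, b] ∧ (a, (0 : V)) ∈ N ∧ (b, a) ∈ N ∧
        ((0 : V), b) ∈ N := fun a b h1 h2 h3 h4 =>
    ⟨a, b, linearIndependent_pair_of_mem h0 h1 h2 h3 h4, h1, h2, h3⟩
  by_cases hab : ∃ α β : ℝ, c = α • a + β • b
  · left
    obtain ⟨α, β, rfl⟩ := hab
    refine deg1 (α • a) (β • b) ?_ ?_ ?_ ?_
    · exact mem (N.smul_mem α ha) rfl (smul_zero _)
    · refine mem (N.sub_mem (N.sub_mem hc (N.smul_mem α ha)) (N.smul_mem β hb)) ?_ ?_ <;> simp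
    · exact mem (N.smul_mem β hb) (smul_zero _) rfl
    · by_contra! h1
      exact hc0 (by rw [h1.1, h1.2, add_zero])
  have hli2 : ∀ s t : ℝ, s • a + t • b = 0 → s = 0 ∧ t = 0 := by
    intro s t hst
    have e : s • a = -(t • b) := eq_neg_of_add_eq_zero_left hst
    have h1 : s • a = 0 := by
      refine h0 _ ?_ ?_
      · simpa using N.smul_mem s ha
      · rw [e]
        simpa using N.smul_mem (-t) hb
    rw [h1, zero_eq_neg] at e
    exact ⟨(smul_eq_zero.1 h1).resolve_right ha0, (smul_eq_zero.1 e).resolve_right hb0⟩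
  have hli : ∀ r s t : ℝ, r • a + s • b + t • c = 0 → r = 0 ∧ s = 0 ∧ t = 0 := by
    intro r s t hrst
    have ht : t = 0 := by
      by_contra ht
      refine hab ⟨-(t⁻¹ * r), -(t⁻¹ * s), ?_⟩
      have h1 : t • c = -(r • a + s • b) := eq_neg_of_add_eq_zero_right hrst
      have h2 : c = t⁻¹ • (t • c) := by rw [smul_smul, inv_mul_cancel₀ ht, one_smul]
      rw [h2, h1]
      module
    subst ht
    rw [zero_smul, add_zero] at hrst
    exact ⟨(hli2 _ _ hrst).1, (hli2 _ _ hrst).2, rfl⟩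
  have hLI : LinearIndependent ℝ ![a, b, c] := by
    rw [Fintype.linearIndependent_iff]
    intro g hg
    simp only [Fin.sum_univ_three, cons_val_zero, cons_val_one, cons_val] at hg
    obtain ⟨h1, h2, h3⟩ := hli _ _ _ hg
    intro i
    fin_cases i
    exacts [h1, h2, h3]
  obtain ⟨α, β, γ, hd'⟩ : ∃ α β γ : ℝ, d = α • a + β • b + γ • c := by
    have : FiniteDimensional ℝ V := Module.finite_of_finrank_pos (by rw [hV]; norm_num)
    let B := basisOfLinearIndependentOfCardEqFinrank hLI (by simp [hV])
    refine ⟨B.repr d 0, B.repr d 1, B.repr d 2, ?_⟩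
    conv_lhs => rw [← B.sum_repr d]
    simp [Fin.sum_univ_three, B]
  -- four kernel vectors in a three-dimensional space are dependent; this element of `N` is what
  -- the dependence says, and the vanishing of `α`, `β` or `γ` lowers the degree of the curve
  have he : (β • b, (2 * α) • a + γ • c) ∈ N := by
    refine mem (N.sub_mem (N.sub_mem (N.sub_mem hd (N.smul_mem α ha)) (N.smul_mem (2 * β) hb))
      (N.smul_mem γ hc)) ?_ ?_
    · simp only [Prod.fst_sub, Prod.smul_fst, hd']
      module
    · simp only [Prod.snd_sub, Prod.smul_snd, hd']
      module
  have hb' : ∀ r : ℝ, ((0 : V), r • b) ∈ N := fun r => mem (N.smul_mem r hb) (smul_zero _) rfl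
  have ha' : ∀ r : ℝ, (r • a, (0 : V)) ∈ N := fun r => mem (N.smul_mem r ha) rfl (smul_zero _)
  have hc' : ∀ r : ℝ, (r • c, r • c) ∈ N := fun r => N.smul_mem r hc
  by_cases hγ : γ = 0
  · left
    rw [hγ, zero_smul, add_zero] at he hd'
    refine deg1 _ _ (ha' (2 * α)) he (hb' β) ?_
    by_contra! h1
    have h2 : α • a = 0 := by
      rw [mul_smul] at h1
      exact (smul_eq_zero.1 h1.1).resolve_left two_ne_zero
    exact hd0 (by rw [hd', h2, h1.2, add_zero])
  have hγc : γ • c ≠ 0 := smul_ne_zero hγ hc0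
  by_cases hα : α = 0
  · left
    rw [hα, mul_zero, zero_smul, zero_add] at he
    refine deg1 (β • b - γ • c) (-β • b) ?_ ?_ (hb' _) ?_
    · refine mem (N.sub_mem he (hc' γ)) ?_ ?_ <;> simp
    · refine mem (N.sub_mem (hb' β) he) ?_ ?_ <;> simp
    · by_contra! h1
      rw [neg_smul, neg_eq_zero] at h1
      rw [h1.2, zero_sub, neg_eq_zero] at h1
      exact hγc h1.1
  by_cases hβ : β = 0
  · left
    rw [hβ, zero_smul] at he
    refine deg1 (-(2 * α) • a) ((2 * α) • a + γ • c) (ha' _) ?_ he ?_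
    · refine mem (N.add_mem (N.sub_mem (hc' γ) he) (ha' (2 * α))) ?_ ?_
      · simp [add_comm]
      · simp
    · by_contra! h1
      rw [neg_smul, neg_eq_zero] at h1
      rw [h1.1, zero_add] at h1
      exact hγc h1.2
  right
  refine ⟨(2 * α) • a, β • b - γ • c - (2 * α) • a, -β • b, ?_, ha' _, ?_, ?_, hb' _⟩
  · rw [Fintype.linearIndependent_iff]
    intro g hg
    simp only [Fin.sum_univ_three, cons_val_zero, cons_val_one, cons_val] at hg
    obtain ⟨h1, h2, h3⟩ := hli ((g 0 - g 1) * (2 * α)) ((g 1 - g 2) * β) (-(g 1 * γ)) (by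
      rw [← hg]
      module)
    have g1 : g 1 = 0 := by simpa [hγ] using h3
    have g0 : g 0 = 0 := by simpa [g1, hα] using h1
    have g2 : g 2 = 0 := by simpa [g1, hβ] using h2
    intro i
    fin_cases i
    exacts [g0, g1, g2]
  · refine mem (N.sub_mem (N.sub_mem he (hc' γ)) (ha' (2 * α))) ?_ ?_ <;> simp
  · refine mem (N.sub_mem (hb' β) he) ?_ ?_
    · simp
    · module

theorem exists_linearEquiv_of_linearIndependent {v : Fin 3 → (Fin 3 → ℝ)}
    (hv : LinearIndependent ℝ v) :
    ∃ P : (Fin 3 → ℝ) ≃ₗ[ℝ] (Fin 3 → ℝ), ∀ z, P z = z 0 • v 0 + z 1 • v 1 + z 2 • v 2 := by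
  let B := basisOfLinearIndependentOfCardEqFinrank hv (by simp)
  refine ⟨B.equivFun.symm, fun z => ?_⟩
  rw [Module.Basis.equivFun_symm_apply, Fin.sum_univ_three]
  simp [B]

theorem exists_linearIndependent_extend_two {a b : Fin 3 → ℝ}
    (h : LinearIndependent ℝ ![a, b]) : ∃ c, LinearIndependent ℝ ![a, b, c] := by
  obtain ⟨c, hc⟩ := exists_linearIndependent_snoc_of_lt_finrank h (by simp)
  have e : (Fin.snoc ![a, b] c : Fin 3 → Fin 3 → ℝ) = ![a, b, c] := by
    funext i
    fin_cases i <;> rfl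
  exact ⟨c, e ▸ hc⟩

theorem exists_linearIndependent_extend_one {a : Fin 3 → ℝ} (h : a ≠ 0) :
    ∃ b c, LinearIndependent ℝ ![a, b, c] := by
  have h1 : LinearIndependent ℝ ![a] := LinearIndependent.of_subsingleton 0 h
  obtain ⟨b, hb⟩ := exists_linearIndependent_snoc_of_lt_finrank h1 (by simp)
  have e : (Fin.snoc ![a] b : Fin 2 → Fin 3 → ℝ) = ![a, b] := by
    funext i
    fin_cases i <;> rfl
  exact ⟨b, exists_linearIndependent_extend_two (e ▸ hb)⟩

end KernelPencil

/-! ### Acoustic tensors that are singular on a plane -/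

section SingularPlane

theorem hasPosSemidefRep_of_zero_on_coordinate_plane {f : QuadraticForm ℝ Mat3}
    (hf : IsNonnegOnRankOne f)
    (h : ∀ s t : ℝ, ∃ x : Fin 3 → ℝ, x ≠ 0 ∧ f (vecMulVec x ![s, t, 0]) = 0) :
    HasPosSemidefRep f := by
  let C : (Fin 3 → ℝ) × (Fin 3 → ℝ) →ₗ[ℝ] Mat3 :=
    { toFun := fun p => vecMulVec p.1 ![1, 0, 0] + vecMulVec p.2 ![0, 1, 0]
      map_add' := fun p q => by
        simp only [Prod.fst_add, Prod.snd_add, add_vecMulVec]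
        abel
      map_smul' := fun c p => by simp [smul_vecMulVec] }
  have hC : ∀ (s t : ℝ) x, C (s • x, t • x) = vecMulVec x ![s, t, 0] := fun s t x => by
    ext i j
    fin_cases j <;> simp [C, vecMulVec_apply, mul_comm]
  obtain ⟨G, hG, hGf⟩ := exists_posSemidef_rep_two _ (Fin 3 → ℝ) rfl (f.comp C) (fun s t v => by
    rw [QuadraticMap.comp_apply, hC]
    exact hf _ _)
  have hmem : ∀ s t x, (s • x, t • x) ∈ nullSubmodule G hG ↔ f (vecMulVec x ![s, t, 0]) = 0 :=
    fun s t x => by rw [mem_nullSubmodule, hGf, QuadraticMap.comp_apply, hC]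
  have hzero : ∀ (P : (Fin 3 → ℝ) ≃ₗ[ℝ] (Fin 3 → ℝ)) (x : Fin 3 → ℝ) (s t : ℝ),
      (s • P x, t • P x) ∈ nullSubmodule G hG →
      (f.comp (coordChange P.toLinearMap (LinearEquiv.refl ℝ (Fin 3 → ℝ)).toLinearMap))
        (vecMulVec x ![s, t, 0]) = 0 := fun P x s t hx => by
    rw [QuadraticMap.comp_apply, coordChange_vecMulVec]
    exact (hmem s t _).1 hx
  set N := nullSubmodule G hG
  rcases exists_kernel_curve (N := N) (by simp) (fun s t => by
    obtain ⟨x, hx, hx0⟩ := h s t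
    exact ⟨x, hx, (hmem s t x).2 hx0⟩) with ⟨x, hx, h1, h2⟩ | ⟨a, b, hab, h1, h2, h3⟩ |
      ⟨a, b, c, habc, h1, h2, h3, h4⟩
  · obtain ⟨b, c, hli⟩ := exists_linearIndependent_extend_one hx
    obtain ⟨P, hP⟩ := exists_linearEquiv_of_linearIndependent hli
    refine HasPosSemidefRep.of_comp_coordChange P (LinearEquiv.refl ℝ _)
      (hasPosSemidefRep_of_zero_line (hf.comp_coordChange _ _) fun s t => hzero P _ s t ?_)
    rw [hP]
    convert N.add_mem (N.smul_mem s h1) (N.smul_mem t h2) using 1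
    simp
  · obtain ⟨c, hli⟩ := exists_linearIndependent_extend_two hab
    obtain ⟨P, hP⟩ := exists_linearEquiv_of_linearIndependent hli
    refine HasPosSemidefRep.of_comp_coordChange P (LinearEquiv.refl ℝ _)
      (hasPosSemidefRep_of_zero_conic (hf.comp_coordChange _ _) fun s t => hzero P _ s t ?_)
    rw [hP]
    convert N.add_mem (N.add_mem (N.smul_mem (s ^ 2) h1) (N.smul_mem (s * t) h2))
      (N.smul_mem (t ^ 2) h3) using 1
    refine Prod.ext ?_ ?_
    · simp [smul_smul, sq]
    · simp [smul_smul, sq, mul_comm]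
  · obtain ⟨P, hP⟩ := exists_linearEquiv_of_linearIndependent habc
    refine HasPosSemidefRep.of_comp_coordChange P (LinearEquiv.refl ℝ _)
      (hasPosSemidefRep_of_zero_cubic (hf.comp_coordChange _ _) fun s t => hzero P _ s t ?_)
    rw [hP]
    convert N.add_mem (N.add_mem (N.add_mem (N.smul_mem (s ^ 3) h1) (N.smul_mem (s ^ 2 * t) h2))
      (N.smul_mem (s * t ^ 2) h3)) (N.smul_mem (t ^ 3) h4) using 1
    refine Prod.ext ?_ ?_
    · simp
      module
    · simp
      module

theorem acousticTensor_apply (f : QuadraticForm ℝ Mat3) (y : Fin 3 → ℝ) (i k : Fin 3) :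
    acousticTensor f y i k = QuadraticMap.associated (R := ℝ) f
      (vecMulVec (Pi.single i 1) y) (vecMulVec (Pi.single k 1) y) := rfl

theorem vecMulVec_eq_sum_single (x y : Fin 3 → ℝ) :
    vecMulVec x y = ∑ i, x i • vecMulVec (Pi.single i (1 : ℝ)) y := by
  ext a b
  fin_cases a <;> simp [Fin.sum_univ_three, vecMulVec_apply]

theorem dotProduct_acousticTensor_mulVec (f : QuadraticForm ℝ Mat3) (x x' y : Fin 3 → ℝ) :
    x ⬝ᵥ (acousticTensor f y *ᵥ x') =
      QuadraticMap.associated (R := ℝ) f (vecMulVec x y) (vecMulVec x' y) := by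
  rw [vecMulVec_eq_sum_single x, vecMulVec_eq_sum_single x']
  simp only [map_sum, LinearMap.sum_apply, map_smul, LinearMap.smul_apply, smul_eq_mul, dotProduct,
    mulVec, acousticTensor_apply, Finset.mul_sum]
  rw [Finset.sum_comm]
  refine Finset.sum_congr rfl fun i _ => Finset.sum_congr rfl fun k _ => ?_
  ring

theorem exists_zero_of_det_eq_zero {f : QuadraticForm ℝ Mat3} {y : Fin 3 → ℝ}
    (h : (acousticTensor f y).det = 0) : ∃ x : Fin 3 → ℝ, x ≠ 0 ∧ f (vecMulVec x y) = 0 := by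
  obtain ⟨x, hx, hx0⟩ := Matrix.exists_mulVec_eq_zero_iff.2 h
  refine ⟨x, hx, ?_⟩
  rw [← associated_self, ← dotProduct_acousticTensor_mulVec, hx0, dotProduct_zero]

/-- If the acoustic tensor of `f` is singular on a plane, then `f` agrees with a positive
semidefinite form at all rank-one matrices. -/
theorem hasPosSemidefRep_of_det_eq_zero_on_plane {f : QuadraticForm ℝ Mat3}
    (hf : IsNonnegOnRankOne f) {v₀ v₁ : Fin 3 → ℝ} (hv : LinearIndependent ℝ ![v₀, v₁])
    (h : ∀ s t : ℝ, (acousticTensor f (s • v₀ + t • v₁)).det = 0) : HasPosSemidefRep f := by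
  obtain ⟨v₂, hli⟩ := exists_linearIndependent_extend_two hv
  obtain ⟨Q, hQ⟩ := exists_linearEquiv_of_linearIndependent hli
  refine HasPosSemidefRep.of_comp_coordChange (LinearEquiv.refl ℝ _) Q
    (hasPosSemidefRep_of_zero_on_coordinate_plane (hf.comp_coordChange _ _) fun s t => ?_)
  obtain ⟨x, hx, hx0⟩ := exists_zero_of_det_eq_zero (h s t)
  refine ⟨x, hx, ?_⟩
  rw [QuadraticMap.comp_apply, coordChange_vecMulVec]
  have : Q ![s, t, 0] = s • v₀ + t • v₁ := by
    rw [hQ]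
    simp
  simpa [this] using hx0

end SingularPlane

/-! ### Inequalities off a zero set -/

section Density

open Polynomial

theorem le_of_le_of_eval_ne_zero {B : ℝ[X]} (hB : B ≠ 0) {F G : ℝ → ℝ} (hF : Continuous F)
    (hG : Continuous G) (h : ∀ z, B.eval z ≠ 0 → F z ≤ G z) (z : ℝ) : F z ≤ G z := by
  have hd : Dense {z : ℝ | B.eval z ≠ 0} := by
    have hfin : {z : ℝ | B.eval z = 0}.Finite := by
      refine (B.roots.toFinset.finite_toSet).subset fun z hz => ?_
      simpa [hB] using hz
    exact hfin.countable.dense_compl ℝ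
  have hc : IsClosed {z | F z ≤ G z} := isClosed_le hF hG
  exact hc.closure_subset_iff.2 (fun z hz => h z hz) (hd z)

theorem le_of_le_of_mvEval_ne_zero {p : MvPolynomial (Fin 3) ℝ} {v : Fin 3 → ℝ}
    (hp : MvPolynomial.eval v p ≠ 0) {F G : (Fin 3 → ℝ) → ℝ} (hF : Continuous F)
    (hG : Continuous G) (h : ∀ y, MvPolynomial.eval y p ≠ 0 → F y ≤ G y) (y : Fin 3 → ℝ) :
    F y ≤ G y := by
  let B : ℝ[X] := MvPolynomial.aeval (fun i => C (y i) + X * C (v i - y i)) p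
  have hB : ∀ t, B.eval t = MvPolynomial.eval (y + t • (v - y)) p := fun t => by
    have : ((evalRingHom t).comp (MvPolynomial.aeval
        (fun i => C (y i) + X * C (v i - y i)) : MvPolynomial (Fin 3) ℝ →ₐ[ℝ] ℝ[X]).toRingHom) =
        MvPolynomial.eval (y + t • (v - y)) := by
      refine MvPolynomial.ringHom_ext (fun r => by simp) fun i => by simp
    exact congrArg (fun φ : MvPolynomial (Fin 3) ℝ →+* ℝ => φ p) this
  have hB0 : B ≠ 0 := by
    intro h0
    apply hp
    have := hB 1
    rw [h0] at this
    simpa using this.symm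
  have hc : Continuous fun t : ℝ => y + t • (v - y) := by fun_prop
  have := le_of_le_of_eval_ne_zero hB0 (hF.comp hc) (hG.comp hc)
    (fun t ht => h _ (by rwa [hB] at ht)) 0
  simpa using this

end Density

/-! ### Divisibility by a cubic with real zeros -/

section Divisibility

open Polynomial

theorem exists_root_of_odd {p : ℝ[X]} (hm : p.Monic) (hp : Odd p.natDegree) :
    ∃ z, p.eval z = 0 := by
  have hdeg : 0 < p.degree := natDegree_pos_iff_degree_pos.1 hp.pos
  have h1 := p.tendsto_atTop_of_leadingCoeff_nonneg hdeg (by rw [hm.leadingCoeff]; norm_num)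
  have hnd : (p.comp (-X)).natDegree = p.natDegree := by simp [natDegree_comp]
  have h2 := (p.comp (-X)).tendsto_atBot_of_leadingCoeff_nonpos
    (natDegree_pos_iff_degree_pos.1 (by rw [hnd]; exact hp.pos))
    (by rw [leadingCoeff_comp (by simp), hm.leadingCoeff]; simp [hp.neg_one_pow])
  obtain ⟨a, ha⟩ := (h1.eventually_gt_atTop 0).exists
  obtain ⟨b, hb⟩ := (h2.eventually_lt_atBot 0).exists
  rw [eval_comp, eval_neg, eval_X] at hb
  exact mem_range_of_exists_le_of_exists_ge p.continuous ⟨-b, hb.le⟩ ⟨a, ha.le⟩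

theorem evalEval_eq_eval_map (u z : ℝ) (P : ℝ[X][X]) :
    P.evalEval u z = (P.map (evalRingHom u)).eval z :=
  (map_evalRingHom_eval u z P).symm

/-- A monic cubic over `ℝ[u]` that has no root in `ℝ[u]` divides every polynomial that vanishes on
its real zero set: otherwise a Bézout identity over `ℝ(u)`, specialised at a suitable real `u`,
would contradict the existence of a real root of the specialised cubic. -/
theorem dvd_of_vanish_on_zeros {P S : ℝ[X][X]} (hP : P.Monic) (hdeg : P.natDegree = 3)
    (hroot : ∀ r : ℝ[X], P.eval r ≠ 0)
    (hS : ∀ u z, P.evalEval u z = 0 → S.evalEval u z = 0) : P ∣ S := by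
  let K := FractionRing ℝ[X]
  let φ := algebraMap ℝ[X] K
  have hφ : Function.Injective φ := IsFractionRing.injective ℝ[X] K
  have hPK : (P.map φ).natDegree = 3 := by rw [hP.natDegree_map, hdeg]
  have hirr : Irreducible (P.map φ) := by
    refine irreducible_of_degree_le_three_of_not_isRoot ?_ fun x hx => ?_
    · rw [hPK]
      simp
    · obtain ⟨r, hr, -⟩ := exists_integer_of_is_root_of_monic hP (r := x) (by
        rw [IsRoot, eval_map] at hx
        exact hx)
      rw [hr, IsRoot, eval_map, eval₂_at_apply] at hx
      exact hroot r (hφ (by rw [hx, map_zero]))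
  by_contra hnd
  have hcop : IsCoprime (P.map φ) (S.map φ) := by
    rw [hirr.coprime_iff_not_dvd, map_dvd_map φ hφ hP]
    exact hnd
  obtain ⟨A, B, hAB⟩ := hcop
  obtain ⟨a, ha, hA⟩ := IsLocalization.integerNormalization_spec (nonZeroDivisors ℝ[X]) A
  obtain ⟨b, hb, hB⟩ := IsLocalization.integerNormalization_spec (nonZeroDivisors ℝ[X]) B
  set A' := IsLocalization.integerNormalization (nonZeroDivisors ℝ[X]) A
  set B' := IsLocalization.integerNormalization (nonZeroDivisors ℝ[X]) B
  have hid : C b * A' * P + C a * B' * S = C (a * b) := by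
    refine map_injective φ hφ ?_
    have hA2 : A'.map φ = C (φ a) * A := by rw [hA, Algebra.smul_def]; rfl
    have hB2 : B'.map φ = C (φ b) * B := by rw [hB, Algebra.smul_def]; rfl
    simp only [Polynomial.map_add, Polynomial.map_mul, map_C, hA2, hB2, map_mul]
    linear_combination (C (φ a) * C (φ b)) * hAB
  have hab : a * b ≠ 0 := mul_ne_zero (nonZeroDivisors.ne_zero ha) (nonZeroDivisors.ne_zero hb)
  obtain ⟨u, hu⟩ : ∃ u, (a * b).eval u ≠ 0 := by
    by_contra! h
    exact hab (Polynomial.funext fun u => by rw [h u, eval_zero])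
  obtain ⟨z, hz⟩ := exists_root_of_odd (hP.map (evalRingHom u)) (by
    rw [hP.natDegree_map, hdeg]
    decide)
  rw [← evalEval_eq_eval_map] at hz
  have h1 := congrArg (evalEval u z) hid
  rw [evalEval_add, evalEval_mul, evalEval_mul _ _ _ S, hz, hS u z hz, evalEval_C] at h1
  simp only [mul_zero, add_zero] at h1
  exact hu h1.symm

theorem natDegree_eq_zero_of_bounded {p : ℝ[X]} {M : ℝ} (h : ∀ z, |p.eval z| ≤ M) :
    p.natDegree = 0 := by
  by_contra hd
  have h1 := p.abs_tendsto_atTop (natDegree_pos_iff_degree_pos.1 (Nat.pos_of_ne_zero hd))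
  obtain ⟨z, hz⟩ := (h1.eventually_gt_atTop M).exists
  exact absurd (h z) (not_le.2 hz)

/-- If `|Q| ≤ c P²` for a monic cubic `P` over `ℝ[u]` without a root in `ℝ[u]`, then `Q` is a
constant multiple of `P²`. -/
theorem exists_eq_const_mul_sq {P Q : ℝ[X][X]} (hP : P.Monic) (hdeg : P.natDegree = 3)
    (hroot : ∀ r : ℝ[X], P.eval r ≠ 0) {c : ℝ}
    (hQ : ∀ u z, P.evalEval u z ≠ 0 → |Q.evalEval u z| ≤ c * P.evalEval u z ^ 2) :
    ∃ k : ℝ, ∀ u z, Q.evalEval u z = k * P.evalEval u z ^ 2 := by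
  have hPu : ∀ u : ℝ, P.map (evalRingHom u) ≠ 0 := fun u => (hP.map _).ne_zero
  have hext : ∀ (F G : ℝ[X][X]) (M : ℝ) (n : ℕ), (∀ u z, P.evalEval u z ≠ 0 →
      |F.evalEval u z| ≤ M * |G.evalEval u z| ^ n) →
      ∀ u z, |F.evalEval u z| ≤ M * |G.evalEval u z| ^ n := by
    intro F G M n h u z
    simp only [evalEval_eq_eval_map] at h ⊢
    refine le_of_le_of_eval_ne_zero (hPu u) ?_ ?_ (h u) z <;> fun_prop
  have h1 := hext Q P c 2 (fun u z h => by rw [sq_abs]; exact hQ u z h)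
  obtain ⟨S, rfl⟩ := dvd_of_vanish_on_zeros hP hdeg hroot (S := Q) (fun u z h => by
    have := h1 u z
    rw [h] at this
    simpa using this)
  have h2 := hext S P c 1 (fun u z h => by
    have h3 := h1 u z
    rw [evalEval_mul, abs_mul] at h3
    have h4 : 0 < |P.evalEval u z| := abs_pos.2 h
    rw [pow_one]
    refine le_of_mul_le_mul_left ?_ h4
    linarith)
  obtain ⟨W, rfl⟩ := dvd_of_vanish_on_zeros hP hdeg hroot (S := S) (fun u z h => by
    have := h2 u z
    rw [h] at this
    simpa using this)
  have h3 := hext W P c 0 (fun u z h => by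
    have h3 := h2 u z
    rw [evalEval_mul, abs_mul] at h3
    have h4 : 0 < |P.evalEval u z| := abs_pos.2 h
    rw [pow_zero, mul_one]
    refine le_of_mul_le_mul_left ?_ h4
    linarith)
  simp only [pow_zero, mul_one] at h3
  have hW : ∀ u z, W.evalEval u z = (W.coeff 0).eval u := by
    intro u z
    have h5 : (W.map (evalRingHom u)).natDegree = 0 :=
      natDegree_eq_zero_of_bounded (M := c) (fun z => by
        rw [← evalEval_eq_eval_map]
        exact h3 u z)
    rw [evalEval_eq_eval_map, eq_C_of_natDegree_eq_zero h5, eval_C, coeff_map]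
    rfl
  have hw : (W.coeff 0).natDegree = 0 := natDegree_eq_zero_of_bounded (M := c) (fun u => by
    rw [← hW u 0]
    exact h3 u 0)
  refine ⟨(W.coeff 0).coeff 0, fun u z => ?_⟩
  rw [evalEval_mul, evalEval_mul, hW, eq_C_of_natDegree_eq_zero hw, eval_C]
  simp
  ring

end Divisibility

/-! ### Ternary cubic forms -/

section Dehomogenization

open Polynomial Filter Topology

/-- The polynomial `p (a + u b + z v)` in `z`, with coefficients in `ℝ[u]`. -/
noncomputable def dehomogenize (a b v : Fin 3 → ℝ) (p : MvPolynomial (Fin 3) ℝ) : ℝ[X][X] :=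
  MvPolynomial.aeval (fun i => C (C (a i)) + C X * C (C (b i)) + X * C (C (v i))) p

theorem evalEval_dehomogenize (a b v : Fin 3 → ℝ) (p : MvPolynomial (Fin 3) ℝ) (u z : ℝ) :
    (dehomogenize a b v p).evalEval u z = MvPolynomial.eval (a + u • b + z • v) p := by
  have : ((evalEvalRingHom u z).comp (MvPolynomial.aeval
      (fun i => C (C (a i)) + C X * C (C (b i)) + X * C (C (v i))) :
        MvPolynomial (Fin 3) ℝ →ₐ[ℝ] ℝ[X][X]).toRingHom) =
      MvPolynomial.eval (a + u • b + z • v) := by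
    refine MvPolynomial.ringHom_ext (fun r => ?_) fun i => ?_
    · simp [Polynomial.algebraMap_apply]
    · simp
      ring
  exact congrArg (fun φ : MvPolynomial (Fin 3) ℝ →+* ℝ => φ p) this

theorem eval_eval_dehomogenize (a b v : Fin 3 → ℝ) (p : MvPolynomial (Fin 3) ℝ) (r : ℝ[X])
    (u : ℝ) : ((dehomogenize a b v p).eval r).eval u =
      MvPolynomial.eval (a + u • b + r.eval u • v) p := by
  have : (((evalRingHom u).comp (evalRingHom r)).comp (MvPolynomial.aeval
      (fun i => C (C (a i)) + C X * C (C (b i)) + X * C (C (v i))) :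
        MvPolynomial (Fin 3) ℝ →ₐ[ℝ] ℝ[X][X]).toRingHom) =
      MvPolynomial.eval (a + u • b + r.eval u • v) := by
    refine MvPolynomial.ringHom_ext (fun r => ?_) fun i => ?_
    · simp [Polynomial.algebraMap_apply]
    · simp
      ring
  exact congrArg (fun φ : MvPolynomial (Fin 3) ℝ →+* ℝ => φ p) this

theorem continuous_mvEval (p : MvPolynomial (Fin 3) ℝ) :
    Continuous fun y => MvPolynomial.eval y p := MvPolynomial.continuous_eval p

variable {p : MvPolynomial (Fin 3) ℝ}

theorem eval_eq_zero_of_smul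
    (hp6 : ∀ (c : ℝ) y, MvPolynomial.eval (c • y) p ^ 2 = c ^ 6 * MvPolynomial.eval y p ^ 2)
    {c : ℝ} (hc : c ≠ 0) {y : Fin 3 → ℝ} (h : MvPolynomial.eval (c • y) p = 0) :
    MvPolynomial.eval y p = 0 := by
  have h1 := hp6 c y
  rw [h] at h1
  have h2 : c ^ 6 ≠ 0 := pow_ne_zero _ hc
  have h3 : MvPolynomial.eval y p ^ 2 = 0 := by
    refine (mul_eq_zero.1 ?_).resolve_left h2
    linarith
  exact pow_eq_zero_iff two_ne_zero |>.1 h3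

/-- On a line in direction `v` with `p v ≠ 0`, a cubic form `p` restricts to a polynomial of degree
three. Only the homogeneity of `p ^ 2` is used. -/
theorem natDegree_and_leadingCoeff {P : ℝ[X]} {w v : Fin 3 → ℝ}
    (hp6 : ∀ (c : ℝ) y, MvPolynomial.eval (c • y) p ^ 2 = c ^ 6 * MvPolynomial.eval y p ^ 2)
    (hv : MvPolynomial.eval v p ≠ 0) (hP : ∀ z, P.eval z = MvPolynomial.eval (w + z • v) p) :
    P.natDegree = 3 ∧ P.leadingCoeff ^ 2 = MvPolynomial.eval v p ^ 2 := by
  have hlim : Tendsto (fun z : ℝ => (P ^ 2).eval z / (X ^ 6 : ℝ[X]).eval z) atTop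
      (𝓝 (MvPolynomial.eval v p ^ 2)) := by
    have h1 : Tendsto (fun z : ℝ => MvPolynomial.eval (z⁻¹ • w + v) p ^ 2) atTop
        (𝓝 (MvPolynomial.eval ((0 : ℝ) • w + v) p ^ 2)) := by
      have hc : Continuous fun t : ℝ => MvPolynomial.eval (t • w + v) p ^ 2 :=
        ((continuous_mvEval p).comp (by fun_prop)).pow 2
      exact (hc.tendsto 0).comp tendsto_inv_atTop_zero
    rw [zero_smul, zero_add] at h1
    refine h1.congr' ?_
    filter_upwards [eventually_ne_atTop 0] with z hz
    have e : w + z • v = z • (z⁻¹ • w + v) := by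
      rw [smul_add, smul_smul, mul_inv_cancel₀ hz, one_smul]
    rw [eval_pow, eval_pow, eval_X, hP, e, hp6]
    field_simp
  have hv2 : MvPolynomial.eval v p ^ 2 ≠ 0 := pow_ne_zero _ hv
  have hX : (X ^ 6 : ℝ[X]) ≠ 0 := pow_ne_zero _ X_ne_zero
  rcases lt_trichotomy (P ^ 2).degree (X ^ 6 : ℝ[X]).degree with h | h | h
  · exact absurd (tendsto_nhds_unique hlim (div_tendsto_atTop_zero_of_degree_lt _ _ h)) hv2
  · have h1 := tendsto_nhds_unique hlim (div_tendsto_atTop_leadingCoeff_div_of_degree_eq _ _ h)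
    have h2 := natDegree_eq_of_degree_eq h
    rw [natDegree_pow, natDegree_X_pow] at h2
    rw [leadingCoeff_pow, leadingCoeff_X_pow, div_one] at h1
    exact ⟨by omega, h1.symm⟩
  · exact absurd (abs_div_tendsto_atTop_atTop_of_degree_gt _ _ h hX)
      (not_tendsto_atTop_of_tendsto_nhds hlim.abs)

/-- A root in `ℝ[u]` of the dehomogenised form is affine, so the form vanishes on a plane. -/
theorem exists_plane_of_root
    (hp6 : ∀ (c : ℝ) y, MvPolynomial.eval (c • y) p ^ 2 = c ^ 6 * MvPolynomial.eval y p ^ 2)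
    {a b v : Fin 3 → ℝ} (hli : LinearIndependent ℝ ![v, a, b])
    (hv : MvPolynomial.eval v p ≠ 0) {r : ℝ[X]} (hr : (dehomogenize a b v p).eval r = 0) :
    ∃ v₀ v₁, LinearIndependent ℝ ![v₀, v₁] ∧
      ∀ s t : ℝ, MvPolynomial.eval (s • v₀ + t • v₁) p = 0 := by
  have hz : ∀ u : ℝ, MvPolynomial.eval (a + u • b + r.eval u • v) p = 0 := fun u => by
    rw [← eval_eval_dehomogenize, hr, eval_zero]
  have hdeg : r.natDegree ≤ 1 := by
    by_contra! hlt
    have hr0 : r ≠ 0 := by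
      rintro rfl
      simp at hlt
    have h0 : Tendsto (fun u : ℝ => (r.eval u)⁻¹) atTop (𝓝 0) := by
      have := div_tendsto_atTop_zero_of_degree_lt (1 : ℝ[X]) r (by
        rw [degree_one, degree_eq_natDegree hr0]
        exact_mod_cast (by omega : 0 < r.natDegree))
      simpa using this
    have h1 : Tendsto (fun u : ℝ => u / r.eval u) atTop (𝓝 0) := by
      have := div_tendsto_atTop_zero_of_degree_lt (X : ℝ[X]) r (by
        rw [degree_X, degree_eq_natDegree hr0]
        exact_mod_cast hlt)
      simpa using this
    have hc : Continuous fun t : ℝ × ℝ => MvPolynomial.eval (t.1 • a + t.2 • b + v) p :=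
      (continuous_mvEval p).comp (by fun_prop)
    have h2 := (hc.tendsto (0, 0)).comp (h0.prodMk_nhds h1)
    simp only [zero_smul, zero_add] at h2
    refine hv (tendsto_nhds_unique h2 (tendsto_const_nhds.congr' ?_))
    have hne : ∀ᶠ u in atTop, r.eval u ≠ 0 := by
      have hfin : {u : ℝ | r.eval u = 0}.Finite := by
        refine (r.roots.toFinset.finite_toSet).subset fun z hz => ?_
        simpa [hr0] using hz
      obtain ⟨M, hM⟩ := hfin.bddAbove
      filter_upwards [eventually_gt_atTop M] with u hu h
      exact absurd (hM h) (not_le.2 hu)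
    filter_upwards [hne] with u hu
    refine (eval_eq_zero_of_smul hp6 hu ?_).symm
    rw [← hz u]
    congr 1
    dsimp only
    rw [smul_add, smul_add, smul_smul, smul_smul, mul_inv_cancel₀ hu, mul_div_cancel₀ _ hu,
      one_smul]
  obtain ⟨β, α, rfl⟩ := exists_eq_X_add_C_of_natDegree_le_one hdeg
  have h1 : ∀ u : ℝ, MvPolynomial.eval ((a + α • v) + u • (b + β • v)) p = 0 := fun u => by
    rw [← hz u]
    congr 2
    simp only [eval_add, eval_mul, eval_C, eval_X]
    module
  refine ⟨a + α • v, b + β • v, ?_, fun s t => ?_⟩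
  · rw [LinearIndependent.pair_iff]
    intro s t hst
    rw [Fintype.linearIndependent_iff] at hli
    have := hli ![s * α + t * β, s, t] (by
      simp only [Fin.sum_univ_three, Matrix.cons_val_zero, Matrix.cons_val_one, Matrix.cons_val]
      rw [← hst]
      module)
    exact ⟨this 1, this 2⟩
  · have hne : ∀ s : ℝ, s ≠ 0 → MvPolynomial.eval (s • (a + α • v) + t • (b + β • v)) p = 0 := by
      intro s hs
      refine eval_eq_zero_of_smul hp6 (inv_ne_zero hs) ?_
      rw [← h1 (s⁻¹ * t), smul_add, smul_smul, smul_smul, inv_mul_cancel₀ hs, one_smul]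
    have hc : Continuous fun s : ℝ =>
        |MvPolynomial.eval (s • (a + α • v) + t • (b + β • v)) p| :=
      ((continuous_mvEval p).comp (by fun_prop)).abs
    have := le_of_le_of_eval_ne_zero (B := X) X_ne_zero hc (continuous_const (y := (0 : ℝ)))
      (fun s hs => by rw [hne s (by simpa using hs), abs_zero]) s
    simpa using this

/-- If a real ternary cubic form `p` does not vanish on a plane, then every sextic form `q` with
`|q| ≤ p ^ 2` is a constant multiple of `p ^ 2`. -/
theorem exists_plane_or_proportional
    (hp6 : ∀ (c : ℝ) y, MvPolynomial.eval (c • y) p ^ 2 = c ^ 6 * MvPolynomial.eval y p ^ 2)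
    {v : Fin 3 → ℝ} (hv : MvPolynomial.eval v p ≠ 0) {q : MvPolynomial (Fin 3) ℝ}
    (hq6 : ∀ (c : ℝ) y, MvPolynomial.eval (c • y) q = c ^ 6 * MvPolynomial.eval y q)
    (hq : ∀ y, MvPolynomial.eval y p ≠ 0 →
      |MvPolynomial.eval y q| ≤ MvPolynomial.eval y p ^ 2) :
    (∃ v₀ v₁, LinearIndependent ℝ ![v₀, v₁] ∧
      ∀ s t : ℝ, MvPolynomial.eval (s • v₀ + t • v₁) p = 0) ∨
    ∃ k : ℝ, ∀ y, MvPolynomial.eval y q = k * MvPolynomial.eval y p ^ 2 := by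
  have hv0 : v ≠ 0 := by
    rintro rfl
    have := hp6 0 0
    simp only [smul_zero] at this
    exact hv (pow_eq_zero_iff two_ne_zero |>.1 (by linarith))
  obtain ⟨a, b, hli⟩ := exists_linearIndependent_extend_one hv0
  set P := dehomogenize a b v p with hPdef
  have hPu : ∀ u : ℝ, (P.map (evalRingHom u)).natDegree = 3 ∧
      (P.map (evalRingHom u)).leadingCoeff ^ 2 = MvPolynomial.eval v p ^ 2 := fun u =>
    natDegree_and_leadingCoeff (w := a + u • b) hp6 hv fun z => by
      rw [← evalEval_eq_eval_map, hPdef, evalEval_dehomogenize]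
  have hcoeff : ∀ n u, (P.coeff n).eval u = (P.map (evalRingHom u)).coeff n := fun n u => by
    rw [coeff_map]
    rfl
  have hc3 : ∀ u, (P.coeff 3).eval u ^ 2 = MvPolynomial.eval v p ^ 2 := fun u => by
    rw [← (hPu u).2, leadingCoeff, (hPu u).1, hcoeff]
  have hdeg3 : (P.coeff 3).natDegree = 0 :=
    natDegree_eq_zero_of_bounded (M := |MvPolynomial.eval v p|) fun u => (sq_le_sq.1 (hc3 u).le)
  obtain ⟨c, hc⟩ : ∃ c, P.coeff 3 = C c := ⟨_, eq_C_of_natDegree_eq_zero hdeg3⟩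
  have hc0 : c ≠ 0 := by
    rintro rfl
    have := hc3 0
    rw [hc, eval_C] at this
    exact hv (pow_eq_zero_iff two_ne_zero |>.1 (by linarith))
  have hdeg : P.natDegree = 3 := by
    refine le_antisymm ?_ (le_natDegree_of_ne_zero (by rw [hc]; simpa using hc0))
    refine natDegree_le_iff_coeff_eq_zero.2 fun n hn => Polynomial.funext fun u => ?_
    rw [hcoeff, eval_zero]
    exact coeff_eq_zero_of_natDegree_lt (by rw [(hPu u).1]; exact hn)
  set P₀ : ℝ[X][X] := C (C c⁻¹) * P with hP₀
  have hunit : (C (c⁻¹) : ℝ[X]) ≠ 0 := by simpa using hc0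
  have hdeg₀ : P₀.natDegree = 3 := by rw [hP₀, natDegree_C_mul hunit, hdeg]
  have hmonic : P₀.Monic := by
    rw [Monic, leadingCoeff, hdeg₀, hP₀, coeff_C_mul, hc, ← C_mul, inv_mul_cancel₀ hc0, C_1]
  have heval₀ : ∀ u z, P₀.evalEval u z = c⁻¹ * MvPolynomial.eval (a + u • b + z • v) p :=
    fun u z => by rw [hP₀, evalEval_mul, evalEval_C, eval_C, hPdef, evalEval_dehomogenize]
  by_cases hroot : ∃ r, P₀.eval r = 0
  · left
    obtain ⟨r, hr⟩ := hroot
    refine exists_plane_of_root hp6 hli hv (r := r) ?_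
    rw [hP₀, eval_mul, eval_C] at hr
    exact (mul_eq_zero.1 hr).resolve_left hunit
  right
  push Not at hroot
  obtain ⟨k, hk⟩ := exists_eq_const_mul_sq (Q := dehomogenize a b v q) hmonic hdeg₀ hroot
    (c := c ^ 2) (fun u z h => by
      rw [heval₀] at h ⊢
      rw [evalEval_dehomogenize, mul_pow, ← mul_assoc, ← mul_pow, mul_inv_cancel₀ hc0, one_pow,
        one_mul]
      exact hq _ (right_ne_zero_of_mul h))
  have hk' : ∀ u z : ℝ, MvPolynomial.eval (a + u • b + z • v) q =
      k * c⁻¹ ^ 2 * MvPolynomial.eval (a + u • b + z • v) p ^ 2 := fun u z => by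
    have := hk u z
    rw [evalEval_dehomogenize, heval₀] at this
    rw [this]
    ring
  refine ⟨k * c⁻¹ ^ 2, fun y => ?_⟩
  obtain ⟨E, hE⟩ := exists_linearEquiv_of_linearIndependent hli
  obtain ⟨z, rfl⟩ := E.surjective y
  -- the affine chart covers all points off a plane; the rest follows by continuity
  have hne : ∀ s : ℝ, s ≠ 0 →
      MvPolynomial.eval (z 0 • v + s • a + z 2 • b) q =
        k * c⁻¹ ^ 2 * MvPolynomial.eval (z 0 • v + s • a + z 2 • b) p ^ 2 := by
    intro s hs
    have e : z 0 • v + s • a + z 2 • b = s • (a + (s⁻¹ * z 2) • b + (s⁻¹ * z 0) • v) := by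
      rw [smul_add, smul_add, smul_smul, smul_smul, mul_inv_cancel_left₀ hs,
        mul_inv_cancel_left₀ hs]
      abel
    rw [e, hq6, hk', hp6]
    ring
  have hcp : ∀ p : MvPolynomial (Fin 3) ℝ, Continuous fun s : ℝ =>
      MvPolynomial.eval (z 0 • v + s • a + z 2 • b) p := fun p =>
    (continuous_mvEval p).comp (by fun_prop)
  have hlim := le_of_le_of_eval_ne_zero (B := X) X_ne_zero
    (F := fun s => |MvPolynomial.eval (z 0 • v + s • a + z 2 • b) q -
        k * c⁻¹ ^ 2 * MvPolynomial.eval (z 0 • v + s • a + z 2 • b) p ^ 2|)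
    (((hcp q).sub (continuous_const.mul ((hcp p).pow 2))).abs) (continuous_const (y := (0 : ℝ)))
    (fun s hs => by rw [hne s (by simpa using hs), sub_self, abs_zero]) (z 1)
  rw [hE]
  simp only [Matrix.cons_val_zero, Matrix.cons_val_one, Matrix.cons_val]
  have := abs_nonpos_iff.1 hlim
  linarith

end Dehomogenization

/-! ### Subtracting the square of a linear form -/

section AcousticTensor

theorem acousticTensor_smul (f : QuadraticForm ℝ Mat3) (c : ℝ) (y : Fin 3 → ℝ) :
    acousticTensor f (c • y) = c ^ 2 • acousticTensor f y := by
  ext i k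
  rw [Matrix.smul_apply, acousticTensor_apply, acousticTensor_apply, vecMulVec_smul, vecMulVec_smul,
    map_smul, map_smul, LinearMap.smul_apply]
  simp only [smul_eq_mul]
  ring

theorem det_acousticTensor_smul (f : QuadraticForm ℝ Mat3) (c : ℝ) (y : Fin 3 → ℝ) :
    (acousticTensor f (c • y)).det = c ^ 6 * (acousticTensor f y).det := by
  rw [acousticTensor_smul, det_smul, Fintype.card_fin]
  ring

/-- The acoustic tensor as a matrix of polynomials. -/
noncomputable def acousticPoly (f : QuadraticForm ℝ Mat3) :
    Matrix (Fin 3) (Fin 3) (MvPolynomial (Fin 3) ℝ) :=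
  Matrix.of fun i k => ∑ j, ∑ l,
    MvPolynomial.X j * MvPolynomial.X l * MvPolynomial.C (biCoeff f i k j l)

theorem map_acousticPoly (f : QuadraticForm ℝ Mat3) (y : Fin 3 → ℝ) :
    (acousticPoly f).map (MvPolynomial.eval y) = acousticTensor f y := by
  ext i k
  rw [acousticTensor_apply, associated_left_eq_sum, map_apply, acousticPoly, of_apply]
  refine Eq.symm ((Finset.sum_eq_single i ?_ ?_).trans ((Finset.sum_eq_single k ?_ ?_).trans ?_))
  · intro b _ hb
    simp [hb]
  · simp
  · intro b _ hb
    simp [hb]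
  · simp
  · simp

/-- The vector `b y` with `ℓ (x ⊗ y) = x ⬝ b y`. -/
def symbol (ℓ : Mat3 →ₗ[ℝ] ℝ) (y : Fin 3 → ℝ) : Fin 3 → ℝ :=
  fun i => ℓ (vecMulVec (Pi.single i 1) y)

/-- The symbol of a linear form as a vector of polynomials. -/
noncomputable def symbolPoly (ℓ : Mat3 →ₗ[ℝ] ℝ) : Fin 3 → MvPolynomial (Fin 3) ℝ :=
  fun i => ∑ j, MvPolynomial.X j *
    MvPolynomial.C (ℓ (vecMulVec (Pi.single i 1) (Pi.single j 1)))

theorem eval_symbolPoly (ℓ : Mat3 →ₗ[ℝ] ℝ) (y : Fin 3 → ℝ) (i : Fin 3) :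
    MvPolynomial.eval y (symbolPoly ℓ i) = symbol ℓ y i := by
  have : vecMulVec (Pi.single i 1) y =
      ∑ j, y j • vecMulVec (Pi.single i (1 : ℝ)) (Pi.single j (1 : ℝ)) := by
    ext a b
    fin_cases b <;> simp [Fin.sum_univ_three, vecMulVec_apply, mul_comm]
  simp [symbolPoly, symbol, this]

theorem dotProduct_symbol (ℓ : Mat3 →ₗ[ℝ] ℝ) (x y : Fin 3 → ℝ) :
    x ⬝ᵥ symbol ℓ y = ℓ (vecMulVec x y) := by
  rw [vecMulVec_eq_sum_single x]
  simp [dotProduct, symbol]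

theorem symbol_smul (ℓ : Mat3 →ₗ[ℝ] ℝ) (c : ℝ) (y : Fin 3 → ℝ) :
    symbol ℓ (c • y) = c • symbol ℓ y := by
  ext i
  simp [symbol, vecMulVec_smul]

/-- The vector `adj (T y) b y`, where `T` is the acoustic tensor of `f` and `b` the symbol of `ℓ`.
Where `T y` is positive definite and `b y ≠ 0`, it spans the kernel of `T y - c • b y (b y)ᵀ` for
the only `c` at which this matrix is singular. -/
noncomputable def adjSymbol (f : QuadraticForm ℝ Mat3) (ℓ : Mat3 →ₗ[ℝ] ℝ) (y : Fin 3 → ℝ) :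
    Fin 3 → ℝ :=
  (acousticTensor f y).adjugate *ᵥ symbol ℓ y

theorem acousticTensor_mulVec_adjSymbol (f : QuadraticForm ℝ Mat3) (ℓ : Mat3 →ₗ[ℝ] ℝ)
    (y : Fin 3 → ℝ) :
    acousticTensor f y *ᵥ adjSymbol f ℓ y = (acousticTensor f y).det • symbol ℓ y := by
  rw [adjSymbol, mulVec_mulVec, mul_adjugate, smul_mulVec, one_mulVec]

/-- The sextic form `b y ⬝ adj (T y) b y`. -/
noncomputable def adjPairing (f : QuadraticForm ℝ Mat3) (ℓ : Mat3 →ₗ[ℝ] ℝ) (y : Fin 3 → ℝ) : ℝ :=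
  adjSymbol f ℓ y ⬝ᵥ symbol ℓ y

theorem exists_poly_adjPairing (f : QuadraticForm ℝ Mat3) (ℓ : Mat3 →ₗ[ℝ] ℝ) :
    ∃ q : MvPolynomial (Fin 3) ℝ, ∀ y, MvPolynomial.eval y q = adjPairing f ℓ y := by
  refine ⟨((acousticPoly f).adjugate *ᵥ symbolPoly ℓ) ⬝ᵥ symbolPoly ℓ, fun y => ?_⟩
  have h1 : (MvPolynomial.eval y : _ → ℝ) ∘ symbolPoly ℓ = symbol ℓ y :=
    funext fun i => eval_symbolPoly ℓ y i
  have h2 : (MvPolynomial.eval y : _ → ℝ) ∘ ((acousticPoly f).adjugate *ᵥ symbolPoly ℓ) =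
      adjSymbol f ℓ y := by
    funext i
    rw [Function.comp_apply, RingHom.map_mulVec, adjSymbol, h1, ← map_acousticPoly]
    congr 2
    exact RingHom.map_adjugate (MvPolynomial.eval y) (acousticPoly f)
  rw [RingHom.map_dotProduct, h1, h2, adjPairing]

theorem adjPairing_smul (f : QuadraticForm ℝ Mat3) (ℓ : Mat3 →ₗ[ℝ] ℝ) (c : ℝ) (y : Fin 3 → ℝ) :
    adjPairing f ℓ (c • y) = c ^ 6 * adjPairing f ℓ y := by
  simp only [adjPairing, adjSymbol, acousticTensor_smul, symbol_smul, adjugate_smul,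
    Fintype.card_fin, smul_mulVec, mulVec_smul, dotProduct_smul, smul_dotProduct, smul_eq_mul]
  ring

theorem associated_adjSymbol (f : QuadraticForm ℝ Mat3) (ℓ : Mat3 →ₗ[ℝ] ℝ) (x y : Fin 3 → ℝ) :
    QuadraticMap.associated (R := ℝ) f (vecMulVec x y) (vecMulVec (adjSymbol f ℓ y) y) =
      (acousticTensor f y).det * ℓ (vecMulVec x y) := by
  rw [← dotProduct_acousticTensor_mulVec, acousticTensor_mulVec_adjSymbol, dotProduct_smul,
    dotProduct_symbol, smul_eq_mul]

theorem apply_adjSymbol (f : QuadraticForm ℝ Mat3) (ℓ : Mat3 →ₗ[ℝ] ℝ) (y : Fin 3 → ℝ) :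
    f (vecMulVec (adjSymbol f ℓ y) y) = (acousticTensor f y).det * adjPairing f ℓ y := by
  rw [← associated_self, associated_adjSymbol, adjPairing, dotProduct_symbol]

theorem squareForm_apply (ℓ : Mat3 →ₗ[ℝ] ℝ) (ξ : Mat3) : squareForm ℓ ξ = ℓ ξ ^ 2 := by
  rw [squareForm, QuadraticMap.linMulLin_apply, sq]

theorem abs_adjPairing_le {f : QuadraticForm ℝ Mat3} {ℓ : Mat3 →ₗ[ℝ] ℝ}
    (hf : IsNonnegOnRankOne f) (hfl : IsNonnegOnRankOne (f - squareForm ℓ)) {y : Fin 3 → ℝ}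
    (hdet : 0 < (acousticTensor f y).det) :
    |adjPairing f ℓ y| ≤ (acousticTensor f y).det := by
  have h1 := hf (adjSymbol f ℓ y) y
  have h2 := hfl (adjSymbol f ℓ y) y
  rw [_root_.sub_apply, squareForm_apply, apply_adjSymbol, ← dotProduct_symbol, ← adjPairing] at h2
  rw [apply_adjSymbol] at h1
  have h3 : 0 ≤ adjPairing f ℓ y := nonneg_of_mul_nonneg_right h1 hdet
  rw [abs_of_nonneg h3]
  by_contra! h4
  nlinarith

/-- Cauchy–Schwarz for `T y` applied to `x` and `adj (T y) b y`. -/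
theorem sq_le_mul_of_adjPairing_eq {f : QuadraticForm ℝ Mat3} {ℓ : Mat3 →ₗ[ℝ] ℝ}
    (hf : IsNonnegOnRankOne f) {y : Fin 3 → ℝ} {k : ℝ} (hdet : (acousticTensor f y).det ≠ 0)
    (hk : adjPairing f ℓ y = k * (acousticTensor f y).det) (x : Fin 3 → ℝ) :
    ℓ (vecMulVec x y) ^ 2 ≤ k * f (vecMulVec x y) := by
  let Y : (Fin 3 → ℝ) →ₗ[ℝ] Mat3 :=
    { toFun := fun x => vecMulVec x y
      map_add' := fun a b => add_vecMulVec a b y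
      map_smul' := fun c a => smul_vecMulVec c a y }
  have h := sq_associated_le (Q := f.comp Y) (fun x => hf x y) x (adjSymbol f ℓ y)
  rw [QuadraticMap.associated_comp] at h
  change (QuadraticMap.associated (R := ℝ) f (vecMulVec x y) (vecMulVec (adjSymbol f ℓ y) y)) ^ 2 ≤
    f (vecMulVec x y) * f (vecMulVec (adjSymbol f ℓ y) y) at h
  rw [associated_adjSymbol, apply_adjSymbol, hk] at h
  have h1 : 0 < (acousticTensor f y).det ^ 2 := by positivity
  refine le_of_mul_le_mul_left ?_ h1
  linarith

theorem eq_zero_of_forall_vecMulVec {ℓ : Mat3 →ₗ[ℝ] ℝ} (h : ∀ x y, ℓ (vecMulVec x y) = 0) :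
    ℓ = 0 := by
  ext ξ
  rw [matrix_eq_sum_single ξ]
  simp [h]

/-- If `b ⬝ adj T b = k * det T` for a constant `k`, then subtracting `k⁻¹ * ℓ ^ 2` makes the
acoustic tensor singular everywhere and keeps the form nonnegative. -/
theorem hasPosSemidefRep_of_adjPairing_eq {f : QuadraticForm ℝ Mat3} {ℓ : Mat3 →ₗ[ℝ] ℝ}
    {p : MvPolynomial (Fin 3) ℝ} {v : Fin 3 → ℝ} {k : ℝ} (hf : IsNonnegOnRankOne f) (hℓ : ℓ ≠ 0)
    (hp : ∀ y, (acousticTensor f y).det = MvPolynomial.eval y p ^ 2)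
    (hv : MvPolynomial.eval v p ≠ 0)
    (hk : ∀ y, adjPairing f ℓ y = k * (acousticTensor f y).det) : HasPosSemidefRep f := by
  have hle : ∀ x y, ℓ (vecMulVec x y) ^ 2 ≤ k * f (vecMulVec x y) := by
    intro x y
    let X : (Fin 3 → ℝ) →ₗ[ℝ] Mat3 :=
      { toFun := fun y => vecMulVec x y
        map_add' := fun a b => vecMulVec_add x a b
        map_smul' := fun c a => vecMulVec_smul c x a }
    have hF : Continuous fun y => ℓ (vecMulVec x y) ^ 2 :=
      ((ℓ ∘ₗ X).continuous_of_finiteDimensional).pow 2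
    have hG : Continuous fun y => k * f (vecMulVec x y) :=
      continuous_const.mul (continuous_quadraticForm (f.comp X))
    refine le_of_le_of_mvEval_ne_zero hv hF hG (fun y hy => ?_) y
    exact sq_le_mul_of_adjPairing_eq hf (by rw [hp]; exact pow_ne_zero _ hy) (hk y) x
  have hk0 : 0 < k := by
    by_contra! hneg
    refine hℓ (eq_zero_of_forall_vecMulVec fun x y => ?_)
    have h1 := hle x y
    have h2 := mul_nonneg (neg_nonneg.2 hneg) (hf x y)
    have h3 : ℓ (vecMulVec x y) ^ 2 = 0 := le_antisymm (by linarith) (sq_nonneg _)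
    exact pow_eq_zero_iff two_ne_zero |>.1 h3
  have happly : ∀ ξ, (f - k⁻¹ • squareForm ℓ) ξ = f ξ - k⁻¹ * ℓ ξ ^ 2 := fun ξ => by
    rw [_root_.sub_apply, _root_.smul_apply, squareForm_apply, smul_eq_mul]
  have hnn : IsNonnegOnRankOne (f - k⁻¹ • squareForm ℓ) := fun x y => by
    have h1 := mul_le_mul_of_nonneg_left (hle x y) (inv_nonneg.2 hk0.le)
    rw [inv_mul_cancel_left₀ hk0.ne'] at h1
    rw [happly]
    linarith
  refine HasPosSemidefRep.add_squareForm (inv_nonneg.2 hk0.le)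
    (hasPosSemidefRep_of_zero_on_coordinate_plane hnn fun s t => ?_)
  set y : Fin 3 → ℝ := ![s, t, 0]
  by_cases hdet : (acousticTensor f y).det = 0
  · obtain ⟨x, hx, hx0⟩ := exists_zero_of_det_eq_zero hdet
    refine ⟨x, hx, le_antisymm ?_ (hnn x y)⟩
    rw [happly, hx0]
    have := mul_nonneg (inv_nonneg.2 hk0.le) (sq_nonneg (ℓ (vecMulVec x y)))
    linarith
  · have hq : adjPairing f ℓ y ≠ 0 := by
      rw [hk]
      exact mul_ne_zero hk0.ne' hdet
    refine ⟨adjSymbol f ℓ y, fun h => hq ?_, ?_⟩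
    · rw [adjPairing, h, zero_dotProduct]
    · rw [happly, apply_adjSymbol, ← dotProduct_symbol, ← adjPairing, hk]
      field_simp
      ring

end AcousticTensor

theorem isExtremalForm_or_hasPosSemidefRep {f : QuadraticForm ℝ Mat3} (hf : IsQuasiconvexForm f)
    (hdet : ∃ p : MvPolynomial (Fin 3) ℝ,
      ∀ y : Fin 3 → ℝ, (acousticTensor f y).det = (MvPolynomial.eval y p) ^ 2) :
    IsExtremalForm f ∨ HasPosSemidefRep f := by
  obtain ⟨p, hp⟩ := hdet
  have hnn := isNonnegOnRankOne_of_isQuasiconvexForm hf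
  by_cases hp0 : ∀ y, MvPolynomial.eval y p = 0
  · right
    refine hasPosSemidefRep_of_zero_on_coordinate_plane hnn fun s t => ?_
    exact exists_zero_of_det_eq_zero (by rw [hp, hp0]; norm_num)
  push Not at hp0
  obtain ⟨v, hv⟩ := hp0
  by_cases hext : IsExtremalForm f
  · exact Or.inl hext
  right
  obtain ⟨ℓ, hℓ, hqc⟩ : ∃ ℓ : Mat3 →ₗ[ℝ] ℝ, ℓ ≠ 0 ∧ IsQuasiconvexForm (f - squareForm ℓ) := by
    by_contra! h
    exact hext ⟨hf, h⟩
  obtain ⟨q, hq⟩ := exists_poly_adjPairing f ℓ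
  rcases exists_plane_or_proportional (p := p) (q := q)
    (fun c y => by rw [← hp, ← hp, det_acousticTensor_smul]) hv
    (fun c y => by rw [hq, hq, adjPairing_smul])
    (fun y hy => by
      rw [hq, ← hp]
      exact abs_adjPairing_le hnn (isNonnegOnRankOne_of_isQuasiconvexForm hqc)
        (by rw [hp]; positivity)) with
    ⟨v₀, v₁, hli, hpl⟩ | ⟨k, hk⟩
  · exact hasPosSemidefRep_of_det_eq_zero_on_plane hnn hli fun s t => by
      rw [hp, hpl]
      norm_num
  · exact hasPosSemidefRep_of_adjPairing_eq hnn hℓ hp hv fun y => by rw [← hq, hk, hp]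

end QuasiconvexForm

theorem theorem3p7 (f : QuadraticForm ℝ Mat3) (hf : IsQuasiconvexForm f)
    (hdet : ∃ p : MvPolynomial (Fin 3) ℝ,
      ∀ y : Fin 3 → ℝ, (acousticTensor f y).det = (MvPolynomial.eval y p) ^ 2) :
    IsExtremalForm f ∨ IsPolyconvexForm f ∨
      ∃ (ℓ : Mat3 →ₗ[ℝ] ℝ) (g : QuadraticForm ℝ Mat3),
        ℓ ≠ 0 ∧ IsExtremalForm g ∧ (∀ y : Fin 3 → ℝ, (acousticTensor g y).det = 0) ∧
          f = squareForm ℓ + g := by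
  rcases QuasiconvexForm.isExtremalForm_or_hasPosSemidefRep hf hdet with h | h
  · exact Or.inl h
  · exact Or.inr (Or.inl h.isPolyconvexForm)
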